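/- Let $\theta\in[0,2\pi)$, $\theta\neq 0,\pi$, and write $c=\cos\theta$, $s=\sin\theta$. Let $\mathcal H_c$ have orthonormal basis $|-1\rangle,|0\rangle,|1\rangle$, in which the coin operator is $$C=\begin{pmatrix}-\frac{1+c}{2}&\frac{s}{\sqrt2}&\frac{1-c}{2}\\ \frac{s}{\sqrt2}&c&\frac{s}{\sqrt2}\\ \frac{1-c}{2}&\frac{s}{\sqrt2}&-\frac{1+c}{2}\end{pmatrix}.$$ On $\ell^2(\mathbb Z)\otimes\mathcal H_c$ let $\tilde C=\mathrm{Id}\otimes C$ and let $\tilde S$ be the shift $\tilde S(|x\rangle\otimes|j\rangle)=|x+j\rangle\otimes|j\rangle$ for $j\in\{-1,0,1\}$. The 3-period time-dependent three-state quantum walk is $$|\Psi_{t+1}\rangle=\tilde S\tilde C|\Psi_t\rangle\ \ (t\equiv 0,1 \bmod 3),\qquad |\Psi_{t+1}\rangle=\tilde S|\Psi_t\rangle\ \ (t\equiv 2\bmod 3),$$ started from $|\Psi_0\rangle=|0\rangle\otimes(\alpha|-1\rangle+\beta|0\rangle+\gamma|1\rangle)$ with $\alpha,\beta,\gamma\in\mathbb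 C$, $|\alpha|^2+|\beta|^2+|\gamma|^2=1$. Its position $X_t$ has law $\mathbb P(X_t=x)=\sum_{j}\bigl|\bigl(\langle x|\otimes\langle j|\bigr)|\Psi_t\rangle\bigr|^2$, $x\in\mathbb Z$. Put $$D(x)=(1-c)\{2(5+4c)-9(1+c)x^2\},$$ $$W_+(x)=1+2c-3cx^2+x\sqrt{D(x)},\qquad W_-(x)=5+4c-3(2+c)x^2-x\sqrt{D(x)},$$ $$f(x)=\frac{(1-c)\{5+4c-(4+5c)x^2+x\sqrt{D(x)}\}}{\pi(5+4c)^2(1-x^2)\sqrt{W_+(x)W_-(x)}\sqrt{D(x)}},$$ $$\xi_\pm(x)=\frac{\pm2(5+4c)+9(1+c)x+\sqrt{D(x)}}{2\sqrt2},$$ $$\chi_1(x)=\frac{3\{s^2x-(1+c)\sqrt{D(x)}\}}{2s},\qquad \chi_2(x)=\frac{3(1-c)(4+3c)x-(2+c)\sqrt{D(x)}}{s},$$ $$\begin{aligned}\nu(\alpha,\beta,\gamma;x)=\ &\xi_-(x)^2|\alpha|^2+\chi_1(x)^2|\beta|^2+\xi_+(x)^2|\gamma|^2-\xi_-(x)\chi_2(x)\Re(\alpha\overline\beta)\\&-\xi_+(x)\chi_2(x)\Re(\beta\overline\gamma)+\Bigl(\chi_1(x)^2-\tfrac{\chi_2(x)^2}{2}\Bigr)\Re(\gamma\overline\alpha),\end{aligned}$$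 $$\mathcal D_1=\Bigl(-\tfrac{1+2c}{3},\tfrac{\sqrt{5+4c}}{3}\Bigr),\qquad \mathcal D_2=\Bigl(-\tfrac{\sqrt{5+4c}}{3},\tfrac{1+2c}{3}\Bigr),$$ $$\rho(y)=\nu(\alpha,\beta,\gamma;y)f(y)I_{\mathcal D_1}(y)+\nu(\gamma,\beta,\alpha;-y)f(-y)I_{\mathcal D_2}(y),$$ where $I_A$ is the indicator function of $A$. Then there is a constant $\Delta(\alpha,\beta,\gamma)\ge 0$, determined by $\alpha,\beta,\gamma$ (and $\theta$), such that $\rho$ is nonnegative and integrable, $\mu(dy)=\Delta(\alpha,\beta,\gamma)\,\delta_0(dy)+\rho(y)\,dy$ is a probability measure on $\mathbb R$, and $X_t/t$ converges in distribution to $\mu$, that is, $$\lim_{t\to\infty}\mathbb P\Bigl(\frac{X_t}{t}\le x\Bigr)=\mu((-\infty,x])$$ for every real $x\ne0$, and also for $x=0$ if $\Delta(\alpha,\beta,\gamma)=0$. Moreover, if $1+2\cos\theta<0$, then $\rho(y)=0$ for all $y$ in the gap $\bigl(\tfrac{1+2c}{3},-\tfrac{1+2c}{3}\bigr)$ around the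 origin. -/

import Mathlib

open MeasureTheory Filter Topology

noncomputable section

namespace QuantumWalk

/-- The coin operator `C` in the basis `|-1⟩, |0⟩, |1⟩`, indexed by `0, 1, 2 : Fin 3`. -/
def coin (θ : ℝ) : Matrix (Fin 3) (Fin 3) ℂ :=
  !![(-((1 + Real.cos θ) / 2) : ℝ), (Real.sin θ / √2 : ℝ), ((1 - Real.cos θ) / 2 : ℝ);
     (Real.sin θ / √2 : ℝ), (Real.cos θ : ℝ), (Real.sin θ / √2 : ℝ);
     ((1 - Real.cos θ) / 2 : ℝ), (Real.sin θ / √2 : ℝ), (-((1 + Real.cos θ) / 2) : ℝ)]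

/-- The coin-flip `∑ₓ |x⟩⟨x| ⊗ C`, acting on amplitudes: `Ψ x j` is the coefficient of `|x⟩ ⊗ |j⟩`. -/
def coinFlip (θ : ℝ) (Ψ : ℤ → Fin 3 → ℂ) : ℤ → Fin 3 → ℂ :=
  fun x => (coin θ).mulVec (Ψ x)

/-- The position shift `|x⟩ ⊗ |j⟩ ↦ |x + j⟩ ⊗ |j⟩` for `j = -1, 0, 1`. -/
def shift (Ψ : ℤ → Fin 3 → ℂ) : ℤ → Fin 3 → ℂ :=
  fun x => ![Ψ (x + 1) 0, Ψ x 1, Ψ (x - 1) 2]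

/-- The state at time `t`, started from `|0⟩ ⊗ (α|-1⟩ + β|0⟩ + γ|1⟩)`. -/
def state (θ : ℝ) (α β γ : ℂ) : ℕ → ℤ → Fin 3 → ℂ
  | 0 => fun x => if x = 0 then ![α, β, γ] else 0
  | t + 1 =>
    if t % 3 = 2 then shift (state θ α β γ t)
    else shift (coinFlip θ (state θ α β γ t))

/-- `ℙ(X_t = x)`. -/
def prob (θ : ℝ) (α β γ : ℂ) (t : ℕ) (x : ℤ) : ℝ :=
  ∑ j, ‖state θ α β γ t x j‖ ^ 2

/-- The law of the position `X_t` on `ℤ`. -/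
def positionLaw (θ : ℝ) (α β γ : ℂ) (t : ℕ) : Measure ℤ :=
  Measure.sum fun x => ENNReal.ofReal (prob θ α β γ t x) • Measure.dirac x

/-- The law of `X_t / t` on `ℝ`. -/
def rescaledLaw (θ : ℝ) (α β γ : ℂ) (t : ℕ) : Measure ℝ :=
  (positionLaw θ α β γ t).map fun x : ℤ => (x : ℝ) / (t : ℝ)

section NormPreservation

/-- The squared norm of a family of amplitudes. -/
def energy (Ψ : ℤ → Fin 3 → ℂ) : ENNReal := ∑' x, ENNReal.ofReal (∑ j, ‖Ψ x j‖ ^ 2)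

theorem energy_shift (Ψ : ℤ → Fin 3 → ℂ) : energy (shift Ψ) = energy Ψ := by
  have key : ∀ Φ : ℤ → Fin 3 → ℂ, energy Φ =
      ∑' x, ENNReal.ofReal (‖Φ x 0‖ ^ 2) + ∑' x, ENNReal.ofReal (‖Φ x 1‖ ^ 2)
        + ∑' x, ENNReal.ofReal (‖Φ x 2‖ ^ 2) := by
    intro Φ
    rw [← ENNReal.tsum_add, ← ENNReal.tsum_add, energy]
    refine tsum_congr fun x => ?_
    rw [Fin.sum_univ_three, ENNReal.ofReal_add (by positivity) (by positivity),
      ENNReal.ofReal_add (by positivity) (by positivity)]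
  rw [key, key]
  have h0 := (Equiv.addRight (1 : ℤ)).tsum_eq fun x => ENNReal.ofReal (‖Ψ x 0‖ ^ 2)
  have h2 := (Equiv.subRight (1 : ℤ)).tsum_eq fun x => ENNReal.ofReal (‖Ψ x 2‖ ^ 2)
  simp only [Equiv.coe_addRight, Equiv.subRight_apply] at h0 h2
  simp only [shift, Matrix.cons_val, h0, h2]

theorem energy_coinFlip (θ : ℝ) (Ψ : ℤ → Fin 3 → ℂ) : energy (coinFlip θ Ψ) = energy Ψ := by
  refine tsum_congr fun x => congrArg ENNReal.ofReal ?_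
  have hu : (Real.sin θ / √2) ^ 2 = (1 - Real.cos θ ^ 2) / 2 := by
    rw [div_pow, Real.sq_sqrt (by norm_num), Real.sin_sq]
  simp only [coinFlip, coin, Matrix.mulVec, dotProduct, Fin.sum_univ_three,
    ← Complex.normSq_eq_norm_sq, Complex.normSq_apply]
  generalize Real.sin θ / √2 = u at *
  generalize Real.cos θ = c at *
  simp only [Matrix.of_apply, Matrix.cons_val, Complex.add_re, Complex.add_im,
    Complex.re_ofReal_mul, Complex.im_ofReal_mul]
  linear_combination (2 * (Ψ x 1).re ^ 2 + ((Ψ x 0).re + (Ψ x 2).re) ^ 2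
    + 2 * (Ψ x 1).im ^ 2 + ((Ψ x 0).im + (Ψ x 2).im) ^ 2) * hu

theorem energy_state (θ : ℝ) (α β γ : ℂ) (h : ‖α‖ ^ 2 + ‖β‖ ^ 2 + ‖γ‖ ^ 2 = 1) (t : ℕ) :
    energy (state θ α β γ t) = 1 := by
  induction t with
  | zero =>
    rw [energy, tsum_eq_single 0]
    · simp [state, Fin.sum_univ_three, h]
    · intro x hx
      simp [state, hx]
  | succ t ih =>
    rw [state]
    split_ifs
    · rw [energy_shift, ih]
    · rw [energy_shift, energy_coinFlip, ih]

/-- `ℙ(X_t = ·)` is a probability distribution whenever the initial state is normalized. -/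
theorem isProbabilityMeasure_positionLaw (θ : ℝ) (α β γ : ℂ)
    (h : ‖α‖ ^ 2 + ‖β‖ ^ 2 + ‖γ‖ ^ 2 = 1) (t : ℕ) :
    IsProbabilityMeasure (positionLaw θ α β γ t) := by
  constructor
  rw [← energy_state θ α β γ h t]
  simp [positionLaw, energy, prob]

end NormPreservation

section LimitDensity

variable (θ : ℝ)

def D (x : ℝ) : ℝ :=
  (1 - Real.cos θ) * (2 * (5 + 4 * Real.cos θ) - 9 * (1 + Real.cos θ) * x ^ 2)

def Wplus (x : ℝ) : ℝ := 1 + 2 * Real.cos θ - 3 * Real.cos θ * x ^ 2 + x * √(D θ x)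

def Wminus (x : ℝ) : ℝ := 5 + 4 * Real.cos θ - 3 * (2 + Real.cos θ) * x ^ 2 - x * √(D θ x)

def ξplus (x : ℝ) : ℝ :=
  (2 * (5 + 4 * Real.cos θ) + 9 * (1 + Real.cos θ) * x + √(D θ x)) / (2 * √2)

def ξminus (x : ℝ) : ℝ :=
  (-2 * (5 + 4 * Real.cos θ) + 9 * (1 + Real.cos θ) * x + √(D θ x)) / (2 * √2)

def χ₁ (x : ℝ) : ℝ :=
  3 * (Real.sin θ ^ 2 * x - (1 + Real.cos θ) * √(D θ x)) / (2 * Real.sin θ)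

def χ₂ (x : ℝ) : ℝ :=
  (3 * (1 - Real.cos θ) * (4 + 3 * Real.cos θ) * x - (2 + Real.cos θ) * √(D θ x)) / Real.sin θ

def f (x : ℝ) : ℝ :=
  (1 - Real.cos θ) * (5 + 4 * Real.cos θ - (4 + 5 * Real.cos θ) * x ^ 2 + x * √(D θ x)) /
    (Real.pi * (5 + 4 * Real.cos θ) ^ 2 * (1 - x ^ 2) * √(Wplus θ x * Wminus θ x) * √(D θ x))

def ν (α β γ : ℂ) (x : ℝ) : ℝ :=
  ξminus θ x ^ 2 * ‖α‖ ^ 2 + χ₁ θ x ^ 2 * ‖β‖ ^ 2 + ξplus θ x ^ 2 * ‖γ‖ ^ 2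
    - ξminus θ x * χ₂ θ x * (α * (starRingEnd ℂ) β).re
    - ξplus θ x * χ₂ θ x * (β * (starRingEnd ℂ) γ).re
    + (χ₁ θ x ^ 2 - χ₂ θ x ^ 2 / 2) * (γ * (starRingEnd ℂ) α).re

def D₁ : Set ℝ := {x | -((1 + 2 * Real.cos θ) / 3) < x ∧ x < √(5 + 4 * Real.cos θ) / 3}

def D₂ : Set ℝ := {x | -(√(5 + 4 * Real.cos θ) / 3) < x ∧ x < (1 + 2 * Real.cos θ) / 3}

/-- The continuous part `ν(α,β,γ;y) f(y) I_{D₁}(y) + ν(γ,β,α;-y) f(-y) I_{D₂}(y)`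
of the limit density. -/
def density (α β γ : ℂ) (y : ℝ) : ℝ :=
  (D₁ θ).indicator (fun y => ν θ α β γ y * f θ y) y
    + (D₂ θ).indicator (fun y => ν θ γ β α (-y) * f θ (-y)) y

/-- The measure with density `Δ δ₀(y) + density(y)`. -/
def limitLaw (α β γ : ℂ) (Δ : ℝ) : Measure ℝ :=
  ENNReal.ofReal Δ • Measure.dirac 0
    + volume.withDensity fun y => ENNReal.ofReal (density θ α β γ y)

end LimitDensity

end QuantumWalk

end

/-!
In the wave-number representation the walk is multiplication by matrices: the shift becomes
`S(k) = diag(e^{ik}, 1, e^{-ik})`, and a period of three time steps becomes `S(k)² C S(k) C`.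
This matrix is explicitly diagonalizable: with
`u = 1 + (1 + c) cos k` and `w = √(u² + s²)`, an orthonormal eigenbasis is given by vectors whose
entries are rational in `u`, `w` and `e^{ik}` and smooth in `k` (`threeStep_eigenvector`,
`star_eigenvector_dotProduct`). One eigenvalue is `1`; the other two are complex conjugate phases
whose logarithmic derivatives are `∓ 3 i h(k)` for the velocity `h = (3u - (1 - c)) / (3w)`
(`hasDerivAt_eigenvalue`). So each time step moves the three bands at velocities `0`, `h`, `-h`.

By Parseval, the characteristic function of `X_t / t` at `ξ` is the mean over `k` of the inner
product of the wave function at `k` with the wave function at `k - ξ / t` (`charFun_rescaledLaw`).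
As `t → ∞`, the cross terms between different bands vanish by orthogonality, the diagonal terms
acquire the phases `e^{iξh}`, and dominated convergence gives the limit
(`tendsto_charFun_rescaledLaw`). By Lévy's continuity theorem it remains to see that this limit is
the characteristic function of the stated measure (`charFun_limitLaw`). The band of velocity `0`
contributes the atom. On the other two, `h` is strictly decreasing on `(0, π)` and maps it onto
`D₁` (`velocity_image`). Substituting `x = h(k)` makes every expression in the density rational in
`u` and `w`, since `√D = (1 - c)(3(1 + c) + u) / w`: the factor `f` is the Jacobian
(`f_velocity`), and `ν` is the weight of the initial state on the band, summed over `±k`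
(`ν_velocity_eq`). The second summand of the density is the mirror image, which belongs to the
band of velocity `-h` (`ν_velocity_eq_swap`).
-/


noncomputable section

namespace QuantumWalk

/-! ### Group velocity and density -/

section Velocity

variable {θ : ℝ}

/-- The quantity `u(k) = 1 + (1 + c) cos k`, an affine reparametrization of `cos k` in which the
group velocity is easily inverted. -/
def bandParam (θ k : ℝ) : ℝ := 1 + (1 + Real.cos θ) * Real.cos k

/-- The positive root `w(k) = √(u(k)² + s²)`. -/
def bandRoot (θ k : ℝ) : ℝ := √(bandParam θ k ^ 2 + Real.sin θ ^ 2)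

/-- The group velocity `h(k) = (3 u(k) - (1 - c)) / (3 w(k))` per time step of one of the two
dispersive bands; the other dispersive band has velocity `-h(k)`. -/
def velocity (θ k : ℝ) : ℝ := (3 * bandParam θ k - (1 - Real.cos θ)) / (3 * bandRoot θ k)

theorem neg_one_lt_cos_of_sin_ne_zero (hs : Real.sin θ ≠ 0) : -1 < Real.cos θ := by
  have h := Real.sin_sq_add_cos_sq θ
  have : 0 < Real.sin θ ^ 2 := by positivity
  nlinarith

theorem cos_lt_one_of_sin_ne_zero (hs : Real.sin θ ≠ 0) : Real.cos θ < 1 := by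
  have h := Real.sin_sq_add_cos_sq θ
  have : 0 < Real.sin θ ^ 2 := by positivity
  nlinarith

theorem bandRoot_pos (hs : Real.sin θ ≠ 0) (k : ℝ) : 0 < bandRoot θ k :=
  Real.sqrt_pos.2 (by positivity)

theorem bandRoot_sq (θ k : ℝ) :
    bandRoot θ k ^ 2 = bandParam θ k ^ 2 + Real.sin θ ^ 2 :=
  Real.sq_sqrt (by positivity)

@[simp] theorem bandParam_neg (θ k : ℝ) : bandParam θ (-k) = bandParam θ k := by
  simp [bandParam]

@[simp] theorem bandRoot_neg (θ k : ℝ) : bandRoot θ (-k) = bandRoot θ k := by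
  simp [bandRoot]

@[simp] theorem velocity_neg (θ k : ℝ) : velocity θ (-k) = velocity θ k := by
  simp [velocity]

theorem continuous_bandParam (θ : ℝ) : Continuous (bandParam θ) := by
  unfold bandParam; fun_prop

theorem continuous_bandRoot (θ : ℝ) : Continuous (bandRoot θ) := by
  have := continuous_bandParam θ
  unfold bandRoot; fun_prop

theorem continuous_velocity (hs : Real.sin θ ≠ 0) : Continuous (velocity θ) := by
  have := continuous_bandParam θ
  have := continuous_bandRoot θ
  unfold velocity
  exact Continuous.div (by fun_prop) (by fun_prop)
    fun k => mul_ne_zero (by norm_num) (bandRoot_pos hs k).ne'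

theorem hasDerivAt_bandParam (θ k : ℝ) :
    HasDerivAt (bandParam θ) (-((1 + Real.cos θ) * Real.sin k)) k := by
  exact (((Real.hasDerivAt_cos k).const_mul (1 + Real.cos θ)).const_add 1).congr_deriv (by ring)

theorem hasDerivAt_bandRoot (hs : Real.sin θ ≠ 0) (k : ℝ) :
    HasDerivAt (bandRoot θ)
      (-(bandParam θ k * ((1 + Real.cos θ) * Real.sin k)) / bandRoot θ k) k := by
  have h := (((hasDerivAt_bandParam θ k).pow 2).add_const (Real.sin θ ^ 2)).sqrt
    (by simp only [Pi.pow_apply]; positivity)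
  refine h.congr_deriv ?_
  have hw : √(bandParam θ k ^ 2 + Real.sin θ ^ 2) = bandRoot θ k := rfl
  have := (bandRoot_pos hs k).ne'
  simp only [Pi.pow_apply, hw]
  field_simp
  push_cast
  ring

/-- The velocity is a strictly monotone function of `cos k`, as its derivative shows. -/
theorem hasDerivAt_velocity (hs : Real.sin θ ≠ 0) (k : ℝ) :
    HasDerivAt (velocity θ)
      (-((1 - Real.cos θ) * (3 * (1 + Real.cos θ) + bandParam θ k) * (1 + Real.cos θ)
        * Real.sin k / (3 * bandRoot θ k ^ 3))) k := by
  have hw := (bandRoot_pos hs k).ne'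
  have h := (((hasDerivAt_bandParam θ k).const_mul 3).sub_const (1 - Real.cos θ)).div
    ((hasDerivAt_bandRoot hs k).const_mul 3) (by positivity)
  refine h.congr_deriv ?_
  have h2 := bandRoot_sq θ k
  have hc := Real.sin_sq_add_cos_sq θ
  field_simp
  linear_combination (-(3 * Real.sin k * (1 + Real.cos θ))) * h2
    - 3 * Real.sin k * (1 + Real.cos θ) * hc

theorem neg_cos_le_bandParam (θ k : ℝ) : -Real.cos θ ≤ bandParam θ k := by
  unfold bandParam
  nlinarith [Real.neg_one_le_cos k, Real.neg_one_le_cos θ]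

theorem one_sub_velocity_sq (hs : Real.sin θ ≠ 0) (k : ℝ) :
    1 - velocity θ k ^ 2 = (1 - Real.cos θ) * (8 + 10 * Real.cos θ + 6 * bandParam θ k)
      / (9 * bandRoot θ k ^ 2) := by
  have hw := (bandRoot_pos hs k).ne'
  have h2 := bandRoot_sq θ k
  have hc := Real.sin_sq_add_cos_sq θ
  unfold velocity
  field_simp
  linear_combination 81 * h2 + 81 * hc

theorem one_sub_velocity_sq_pos (hs : Real.sin θ ≠ 0) (k : ℝ) : 0 < 1 - velocity θ k ^ 2 := by
  rw [one_sub_velocity_sq hs]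
  have := bandRoot_pos hs k
  have h1 := neg_one_lt_cos_of_sin_ne_zero hs
  have h2 := cos_lt_one_of_sin_ne_zero hs
  have h3 := neg_cos_le_bandParam θ k
  have : 0 < 1 - Real.cos θ := by linarith
  have : 0 < 8 + 10 * Real.cos θ + 6 * bandParam θ k := by linarith
  positivity

/-- In the wave-number coordinate the discriminant `D` is a perfect square. -/
theorem sqrt_D_velocity (hs : Real.sin θ ≠ 0) (k : ℝ) :
    √(D θ (velocity θ k)) =
      (1 - Real.cos θ) * (3 * (1 + Real.cos θ) + bandParam θ k) / bandRoot θ k := by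
  have hw := bandRoot_pos hs k
  have h1 := neg_one_lt_cos_of_sin_ne_zero hs
  have h2 := cos_lt_one_of_sin_ne_zero hs
  have h3 := neg_cos_le_bandParam θ k
  have : 0 < 1 - Real.cos θ := by linarith
  have : 0 < 3 * (1 + Real.cos θ) + bandParam θ k := by linarith
  have key : D θ (velocity θ k) =
      ((1 - Real.cos θ) * (3 * (1 + Real.cos θ) + bandParam θ k) / bandRoot θ k) ^ 2 := by
    have h2 := bandRoot_sq θ k
    have hc := Real.sin_sq_add_cos_sq θ
    unfold D velocity
    field_simp
    linear_combination 18 * (5 + 4 * Real.cos θ) * (h2 + hc)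
  rw [key, Real.sqrt_sq (by positivity)]

theorem Wplus_velocity (hs : Real.sin θ ≠ 0) (k : ℝ) :
    Wplus θ (velocity θ k) =
      3 * (1 - velocity θ k ^ 2) * ((1 + Real.cos θ) * (1 + Real.cos k)) := by
  have hw := bandRoot_pos hs k
  have h2 := bandRoot_sq θ k
  have hc := Real.sin_sq_add_cos_sq θ
  have hz : (1 + Real.cos θ) * (1 + Real.cos k) = bandParam θ k + Real.cos θ := by
    unfold bandParam; ring
  rw [one_sub_velocity_sq hs, hz]
  unfold Wplus
  rw [sqrt_D_velocity hs]
  unfold velocity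
  field_simp
  linear_combination 27 * (1 + 2 * Real.cos θ) * (h2 + hc)

theorem Wminus_velocity (hs : Real.sin θ ≠ 0) (k : ℝ) :
    Wminus θ (velocity θ k) =
      3 * (1 - velocity θ k ^ 2) * ((1 + Real.cos θ) * (1 - Real.cos k)) := by
  have hw := bandRoot_pos hs k
  have h2 := bandRoot_sq θ k
  have hc := Real.sin_sq_add_cos_sq θ
  have hz : (1 + Real.cos θ) * (1 - Real.cos k) = 2 + Real.cos θ - bandParam θ k := by
    unfold bandParam; ring
  rw [one_sub_velocity_sq hs, hz]
  unfold Wminus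
  rw [sqrt_D_velocity hs]
  unfold velocity
  field_simp
  linear_combination 27 * (5 + 4 * Real.cos θ) * (h2 + hc)

/-- In the wave-number coordinate, the factor `f` of the density is the Jacobian of the velocity,
up to normalization. -/
theorem f_velocity (hs : Real.sin θ ≠ 0) {k : ℝ} (hk : 0 < Real.sin k) :
    f θ (velocity θ k) = 3 * bandRoot θ k ^ 3 / (2 * Real.pi * (5 + 4 * Real.cos θ) ^ 2
      * (1 + Real.cos θ) * Real.sin k
      * ((1 - Real.cos θ) * (3 * (1 + Real.cos θ) + bandParam θ k))) := by
  have hw := bandRoot_pos hs k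
  have h1 := neg_one_lt_cos_of_sin_ne_zero hs
  have h2 := cos_lt_one_of_sin_ne_zero hs
  have h3 := neg_cos_le_bandParam θ k
  have ha : 0 < 1 - Real.cos θ := by linarith
  have hb : 0 < 1 + Real.cos θ := by linarith
  have hbu : 0 < 3 * (1 + Real.cos θ) + bandParam θ k := by linarith
  have hd : 0 < 8 + 10 * Real.cos θ + 6 * bandParam θ k := by linarith
  have h5 : 0 < 5 + 4 * Real.cos θ := by linarith
  have hx := one_sub_velocity_sq_pos hs k
  -- The square root is `|sin k|` up to positive factors, and `sin k > 0` on `(0, π)`.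
  have hW : √(Wplus θ (velocity θ k) * Wminus θ (velocity θ k)) =
      3 * (1 - velocity θ k ^ 2) * ((1 + Real.cos θ) * Real.sin k) := by
    have : Wplus θ (velocity θ k) * Wminus θ (velocity θ k) =
        (3 * (1 - velocity θ k ^ 2) * ((1 + Real.cos θ) * Real.sin k)) ^ 2 := by
      rw [Wplus_velocity hs, Wminus_velocity hs]
      linear_combination (-(9 * (1 - velocity θ k ^ 2) ^ 2 * (1 + Real.cos θ) ^ 2))
        * Real.sin_sq_add_cos_sq k
    rw [this, Real.sqrt_sq (by positivity)]
  have hnum : 5 + 4 * Real.cos θ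
      - (4 + 5 * Real.cos θ) * velocity θ k ^ 2 + velocity θ k * √(D θ (velocity θ k)) =
      9 * bandRoot θ k ^ 2 * (1 - velocity θ k ^ 2) ^ 2 / (2 * (1 - Real.cos θ)) := by
    have h2 := bandRoot_sq θ k
    have hc := Real.sin_sq_add_cos_sq θ
    rw [one_sub_velocity_sq hs, sqrt_D_velocity hs]
    unfold velocity
    field_simp
    linear_combination 162 * (5 + 4 * Real.cos θ) * (h2 + hc)
  unfold f
  rw [hnum, hW, sqrt_D_velocity hs]
  generalize 1 - velocity θ k ^ 2 = x at *
  field_simp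
  norm_num

/-- In the wave-number coordinate, the factor `ν` of the density is a quadratic form with entries
polynomial in `r = u / w`, `q = s / (√2 w)` and `cos k`. -/
theorem ν_velocity (hs : Real.sin θ ≠ 0) (α β γ : ℂ) (k : ℝ) {r q : ℝ}
    (hr : r = bandParam θ k / bandRoot θ k) (hq : q = Real.sin θ / (√2 * bandRoot θ k)) :
    ν θ α β γ (velocity θ k) = (5 + 4 * Real.cos θ) ^ 2 *
      ((1 - r) ^ 2 / 2 * ‖α‖ ^ 2 + 2 * q ^ 2 * ‖β‖ ^ 2 + (1 + r) ^ 2 / 2 * ‖γ‖ ^ 2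
        + 2 * q * Real.cos k * (1 - r) * (α * (starRingEnd ℂ) β).re
        - 2 * q * Real.cos k * (1 + r) * (β * (starRingEnd ℂ) γ).re
        - 2 * q ^ 2 * (2 * Real.cos k ^ 2 - 1) * (γ * (starRingEnd ℂ) α).re) := by
  have hw := bandRoot_pos hs k
  have hc := Real.sin_sq_add_cos_sq θ
  have h2 : √2 ^ 2 = 2 := Real.sq_sqrt (by norm_num)
  have h2p : 0 < √2 := by positivity
  have hξp : ξplus θ (velocity θ k) = (5 + 4 * Real.cos θ) * (r + 1) / √2 := by
    unfold ξplus
    rw [sqrt_D_velocity hs, hr]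
    unfold velocity
    field_simp
    ring
  have hξm : ξminus θ (velocity θ k) = (5 + 4 * Real.cos θ) * (r - 1) / √2 := by
    unfold ξminus
    rw [sqrt_D_velocity hs, hr]
    unfold velocity
    field_simp
    ring
  have hχ₁ : χ₁ θ (velocity θ k) = -((5 + 4 * Real.cos θ) * √2 * q) := by
    unfold χ₁
    rw [sqrt_D_velocity hs, hq]
    unfold velocity
    field_simp
    linear_combination (9 + 9 * Real.cos θ + 3 * bandParam θ k) * hc
  have hχ₂ : χ₂ θ (velocity θ k) = (5 + 4 * Real.cos θ) * (2 * √2) * q * Real.cos k := by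
    unfold χ₂
    rw [sqrt_D_velocity hs, hq]
    unfold velocity bandParam
    field_simp
    linear_combination (-(2 * Real.cos k * (5 + 4 * Real.cos θ))) * hc
  unfold ν
  rw [hξp, hξm, hχ₁, hχ₂]
  field_simp
  have h4 : √2 ^ 4 = 4 := by
    rw [show √2 ^ 4 = (√2 ^ 2) ^ 2 by ring, h2]; norm_num
  rw [h4, h2]
  ring

end Velocity

/-! ### Change of variables from velocities to wave numbers -/

section ChangeOfVariables

variable {θ : ℝ}

theorem velocity_zero (hs : Real.sin θ ≠ 0) : velocity θ 0 = √(5 + 4 * Real.cos θ) / 3 := by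
  have h1 := neg_one_lt_cos_of_sin_ne_zero hs
  have h5 : 0 < 5 + 4 * Real.cos θ := by linarith
  have hw : bandRoot θ 0 = √(5 + 4 * Real.cos θ) := by
    unfold bandRoot bandParam
    rw [Real.cos_zero, Real.sin_sq]
    ring_nf
  unfold velocity
  rw [hw, div_eq_div_iff (by positivity) (by norm_num), bandParam, Real.cos_zero]
  nlinarith [Real.sq_sqrt h5.le]

theorem velocity_pi (θ : ℝ) : velocity θ Real.pi = -((1 + 2 * Real.cos θ) / 3) := by
  have hw : bandRoot θ Real.pi = 1 := by
    unfold bandRoot bandParam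
    rw [Real.cos_pi, Real.sin_sq]
    ring_nf
    simp
  unfold velocity
  rw [hw, bandParam, Real.cos_pi]
  ring

theorem strictAntiOn_velocity (hs : Real.sin θ ≠ 0) :
    StrictAntiOn (velocity θ) (Set.Icc 0 Real.pi) := by
  refine strictAntiOn_of_deriv_neg (convex_Icc _ _) (continuous_velocity hs).continuousOn ?_
  intro k hk
  rw [interior_Icc] at hk
  rw [(hasDerivAt_velocity hs k).deriv, neg_lt_zero]
  have := Real.sin_pos_of_mem_Ioo hk
  have hw := bandRoot_pos hs k
  have h1 := neg_one_lt_cos_of_sin_ne_zero hs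
  have h2 := cos_lt_one_of_sin_ne_zero hs
  have h3 := neg_cos_le_bandParam θ k
  have ha : 0 < 1 - Real.cos θ := by linarith
  have hb : 0 < 1 + Real.cos θ := by linarith
  have hbu : 0 < 3 * (1 + Real.cos θ) + bandParam θ k := by linarith
  positivity

/-- The endpoints of `D₁` are the velocities at the wave numbers `π` and `0`. -/
theorem velocity_image (hs : Real.sin θ ≠ 0) : velocity θ '' Set.Ioo 0 Real.pi = D₁ θ := by
  have hπ := Real.pi_pos
  have h : D₁ θ = Set.Ioo (velocity θ Real.pi) (velocity θ 0) := by
    rw [velocity_pi, velocity_zero hs]; rfl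
  rw [h]
  apply Set.Subset.antisymm
  · rintro _ ⟨k, hk, rfl⟩
    have hk' := Set.Ioo_subset_Icc_self hk
    exact ⟨strictAntiOn_velocity hs hk' (Set.right_mem_Icc.2 hπ.le) hk.2,
      strictAntiOn_velocity hs (Set.left_mem_Icc.2 hπ.le) hk' hk.1⟩
  · exact intermediate_value_Ioo' hπ.le (continuous_velocity hs).continuousOn

/-- The Jacobian of the velocity cancels the factor `f` of the density. -/
theorem abs_jacobian_mul_f (hs : Real.sin θ ≠ 0) {k : ℝ} (hk : k ∈ Set.Ioo 0 Real.pi) :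
    |-((1 - Real.cos θ) * (3 * (1 + Real.cos θ) + bandParam θ k) * (1 + Real.cos θ)
        * Real.sin k / (3 * bandRoot θ k ^ 3))| * f θ (velocity θ k) =
      1 / (2 * Real.pi * (5 + 4 * Real.cos θ) ^ 2) := by
  have hk := Real.sin_pos_of_mem_Ioo hk
  have hw := bandRoot_pos hs k
  have h1 := neg_one_lt_cos_of_sin_ne_zero hs
  have h2 := cos_lt_one_of_sin_ne_zero hs
  have h3 := neg_cos_le_bandParam θ k
  have ha : 0 < 1 - Real.cos θ := by linarith
  have hb : 0 < 1 + Real.cos θ := by linarith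
  have h5 : 0 < 5 + 4 * Real.cos θ := by linarith
  have hbu : 0 < 3 * (1 + Real.cos θ) + bandParam θ k := by linarith
  rw [abs_neg, abs_of_pos (by positivity), f_velocity hs hk]
  field_simp

theorem f_nonneg (hs : Real.sin θ ≠ 0) {x : ℝ} (hx : x ∈ D₁ θ) : 0 ≤ f θ x := by
  rw [← velocity_image hs] at hx
  obtain ⟨k, hk, rfl⟩ := hx
  have h := abs_jacobian_mul_f hs hk
  have h1 := neg_one_lt_cos_of_sin_ne_zero hs
  have h5 : 0 < 5 + 4 * Real.cos θ := by linarith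
  have hpos : 0 < 1 / (2 * Real.pi * (5 + 4 * Real.cos θ) ^ 2) := by positivity
  by_contra! hf
  exact (h ▸ hpos).not_ge (mul_nonpos_of_nonneg_of_nonpos (abs_nonneg _) hf.le)

theorem measurableSet_D₁ (θ : ℝ) : MeasurableSet (D₁ θ) := measurableSet_Ioo

theorem mem_D₂_iff {x : ℝ} : x ∈ D₂ θ ↔ -x ∈ D₁ θ := by
  simp only [D₁, D₂, Set.mem_ofPred_eq]
  constructor <;> rintro ⟨h1, h2⟩ <;> constructor <;> linarith

variable {α β γ : ℂ} {W : ℝ → ℝ}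

theorem abs_jacobian_mul_ν_mul_f (hs : Real.sin θ ≠ 0)
    (hW : ∀ k, ν θ α β γ (velocity θ k) = (5 + 4 * Real.cos θ) ^ 2 * W k)
    {k : ℝ} (hk : k ∈ Set.Ioo 0 Real.pi) :
    |-((1 - Real.cos θ) * (3 * (1 + Real.cos θ) + bandParam θ k) * (1 + Real.cos θ)
        * Real.sin k / (3 * bandRoot θ k ^ 3))|
      * (ν θ α β γ (velocity θ k) * f θ (velocity θ k)) = W k / (2 * Real.pi) := by
  have h1 := neg_one_lt_cos_of_sin_ne_zero hs
  have h5 : 0 < 5 + 4 * Real.cos θ := by linarith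
  rw [mul_left_comm, abs_jacobian_mul_f hs hk, hW]
  field_simp

/-- If `ν` in the wave-number coordinate is the weight `W`, integrals against the density over the
velocity interval `D₁` are integrals against `W / 2π` over the wave numbers in `(0, π)`. -/
theorem setIntegral_D₁ (hs : Real.sin θ ≠ 0)
    (hW : ∀ k, ν θ α β γ (velocity θ k) = (5 + 4 * Real.cos θ) ^ 2 * W k) (g : ℝ → ℂ) :
    ∫ x in D₁ θ, (ν θ α β γ x * f θ x) • g x =
      ∫ k in Set.Ioo 0 Real.pi, (W k / (2 * Real.pi)) • g (velocity θ k) := by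
  rw [← velocity_image hs, integral_image_eq_integral_abs_deriv_smul measurableSet_Ioo
    (fun k _ => (hasDerivAt_velocity hs k).hasDerivWithinAt)
    ((strictAntiOn_velocity hs).injOn.mono Set.Ioo_subset_Icc_self)]
  refine setIntegral_congr_fun measurableSet_Ioo fun k hk => ?_
  rw [smul_smul, abs_jacobian_mul_ν_mul_f hs hW hk]

theorem integrableOn_D₁ (hs : Real.sin θ ≠ 0)
    (hW : ∀ k, ν θ α β γ (velocity θ k) = (5 + 4 * Real.cos θ) ^ 2 * W k) (hc : Continuous W) :
    IntegrableOn (fun x => ν θ α β γ x * f θ x) (D₁ θ) := by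
  rw [← velocity_image hs, integrableOn_image_iff_integrableOn_abs_deriv_smul measurableSet_Ioo
    (fun k _ => (hasDerivAt_velocity hs k).hasDerivWithinAt)
    ((strictAntiOn_velocity hs).injOn.mono Set.Ioo_subset_Icc_self)]
  refine IntegrableOn.congr_fun (f := fun k => W k / (2 * Real.pi)) ?_ (fun k hk => ?_)
    measurableSet_Ioo
  · exact ((hc.div_const _).continuousOn.integrableOn_Icc).mono_set Set.Ioo_subset_Icc_self
  · simp only [smul_eq_mul]
    rw [abs_jacobian_mul_ν_mul_f hs hW hk]

theorem ν_mul_f_nonneg (hs : Real.sin θ ≠ 0)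
    (hW : ∀ k, ν θ α β γ (velocity θ k) = (5 + 4 * Real.cos θ) ^ 2 * W k) (h0 : ∀ k, 0 ≤ W k)
    {x : ℝ} (hx : x ∈ D₁ θ) : 0 ≤ ν θ α β γ x * f θ x := by
  refine mul_nonneg ?_ (f_nonneg hs hx)
  rw [← velocity_image hs] at hx
  obtain ⟨k, -, rfl⟩ := hx
  rw [hW]
  exact mul_nonneg (sq_nonneg _) (h0 k)

variable {W' : ℝ → ℝ}

theorem density_nonneg (hs : Real.sin θ ≠ 0)
    (hW : ∀ k, ν θ α β γ (velocity θ k) = (5 + 4 * Real.cos θ) ^ 2 * W k) (h0 : ∀ k, 0 ≤ W k)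
    (hW' : ∀ k, ν θ γ β α (velocity θ k) = (5 + 4 * Real.cos θ) ^ 2 * W' k) (h0' : ∀ k, 0 ≤ W' k)
    (y : ℝ) : 0 ≤ density θ α β γ y :=
  add_nonneg (Set.indicator_nonneg (fun _ hx => ν_mul_f_nonneg hs hW h0 hx) _)
    (Set.indicator_nonneg (fun _ hx => ν_mul_f_nonneg hs hW' h0' (mem_D₂_iff.1 hx)) _)

theorem indicator_D₂ (F : ℝ → ℝ) :
    (D₂ θ).indicator (fun y => F (-y)) = fun y => (D₁ θ).indicator F (-y) := by
  ext y
  by_cases hy : y ∈ D₂ θ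
  · rw [Set.indicator_of_mem hy, Set.indicator_of_mem (mem_D₂_iff.1 hy)]
  · rw [Set.indicator_of_notMem hy, Set.indicator_of_notMem (mt mem_D₂_iff.2 hy)]

/-- The second summand of the density is the reflection of the first one with `α` and `γ`
exchanged. -/
theorem density_eq (θ : ℝ) (α β γ : ℂ) : density θ α β γ = fun y =>
    (D₁ θ).indicator (fun y => ν θ α β γ y * f θ y) y
      + (D₁ θ).indicator (fun y => ν θ γ β α y * f θ y) (-y) := by
  ext y
  rw [density, indicator_D₂ (fun y => ν θ γ β α y * f θ y)]

theorem integrable_density (hs : Real.sin θ ≠ 0)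
    (hW : ∀ k, ν θ α β γ (velocity θ k) = (5 + 4 * Real.cos θ) ^ 2 * W k) (hc : Continuous W)
    (hW' : ∀ k, ν θ γ β α (velocity θ k) = (5 + 4 * Real.cos θ) ^ 2 * W' k)
    (hc' : Continuous W') : Integrable (density θ α β γ) := by
  rw [density_eq]
  exact ((integrable_indicator_iff (measurableSet_D₁ θ)).2 (integrableOn_D₁ hs hW hc)).add
    (((integrable_indicator_iff (measurableSet_D₁ θ)).2 (integrableOn_D₁ hs hW' hc')).comp_neg)

/-- Integrals of bounded functions against the density, in the wave-number coordinate. -/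
theorem integral_density (hs : Real.sin θ ≠ 0)
    (hW : ∀ k, ν θ α β γ (velocity θ k) = (5 + 4 * Real.cos θ) ^ 2 * W k) (hc : Continuous W)
    (hW' : ∀ k, ν θ γ β α (velocity θ k) = (5 + 4 * Real.cos θ) ^ 2 * W' k)
    (hc' : Continuous W') {g : ℝ → ℂ} (hg : Continuous g) {M : ℝ} (hM : ∀ x, ‖g x‖ ≤ M) :
    ∫ y, density θ α β γ y • g y =
      (∫ k in Set.Ioo 0 Real.pi, (W k / (2 * Real.pi)) • g (velocity θ k))
        + ∫ k in Set.Ioo 0 Real.pi, (W' k / (2 * Real.pi)) • g (-velocity θ k) := by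
  have h1 := (integrable_indicator_iff (measurableSet_D₁ θ)).2 (integrableOn_D₁ hs hW hc)
  have h2 := (integrable_indicator_iff (measurableSet_D₁ θ)).2 (integrableOn_D₁ hs hW' hc')
  rw [density_eq]
  simp only [add_smul]
  rw [integral_add]
  · congr 1
    · rw [← setIntegral_D₁ hs hW, ← integral_indicator (measurableSet_D₁ θ)]
      congr 1 with y
      by_cases hy : y ∈ D₁ θ <;> simp [hy]
    · rw [← integral_neg_eq_self, ← setIntegral_D₁ hs hW' fun y => g (-y),
        ← integral_indicator (measurableSet_D₁ θ)]
      congr 1 with y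
      by_cases hy : y ∈ D₁ θ <;> simp [hy]
  · exact h1.smul_bdd M hg.aestronglyMeasurable (Eventually.of_forall hM)
  · exact h2.comp_neg.smul_bdd M hg.aestronglyMeasurable (Eventually.of_forall hM)

end ChangeOfVariables

/-! ### Eigenvectors of three time steps -/

section Eigensystem

open Matrix Complex

variable {θ : ℝ}

/-- The Fourier symbol `diag(e^{ik}, 1, e^{-ik})` of the shift. -/
def shiftSymbol (k : ℝ) : Matrix (Fin 3) (Fin 3) ℂ :=
  Matrix.diagonal ![cexp (k * I), 1, cexp (-(k * I))]

/-- The ratio `r = u / w`. -/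
def bandCos (θ k : ℝ) : ℝ := bandParam θ k / bandRoot θ k

/-- The ratio `q = s / (√2 w)`. -/
def bandSin (θ k : ℝ) : ℝ := Real.sin θ / (√2 * bandRoot θ k)

/-- The eigenvector of the symbol of three time steps for the eigenvalue `1`. -/
def flatVector (θ k : ℝ) : Fin 3 → ℂ :=
  ![bandSin θ k * cexp (k * I), bandCos θ k, bandSin θ k * cexp (-(k * I))]

/-- The eigenvectors of the symbol of three time steps for the two dispersive bands, which are
distinguished by a sign `ε = ± 1`. -/
def bandVector (θ ε k : ℝ) : Fin 3 → ℂ :=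
  ![(1 - ε * bandCos θ k) / 2 * cexp (k * I), ε * bandSin θ k,
    -((1 + ε * bandCos θ k) / 2 * cexp (-(k * I)))]

/-- The eigenvalues of the symbol of three time steps on the two dispersive bands. The branch of
the square root is chosen so that they are smooth functions of the wave number. -/
def bandValue (θ ε k : ℝ) : ℂ :=
  ((1 - (1 - Real.cos k) * bandRoot θ k ^ 2 : ℝ) : ℂ)
    - ε * ((Real.sin k * ((1 + Real.cos θ) * Real.cos k - Real.cos θ) * bandRoot θ k : ℝ) : ℂ) * I

/-- The eigenvectors of the symbol of three time steps. Index `0` is the band of eigenvalue `1`,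
indices `1` and `2` are the dispersive bands with signs `1` and `-1`. -/
def eigenvector (θ : ℝ) (j : Fin 3) (k : ℝ) : Fin 3 → ℂ :=
  ![flatVector θ k, bandVector θ 1 k, bandVector θ (-1) k] j

/-- The eigenvalues of the symbol of three time steps, indexed by the band. -/
def eigenvalue (θ : ℝ) (j : Fin 3) (k : ℝ) : ℂ :=
  ![1, bandValue θ 1 k, bandValue θ (-1) k] j

/-- The velocities of the bands: `0` for the band of eigenvalue `1`, then `h` and `-h`. -/
def bandVelocity (θ : ℝ) (j : Fin 3) (k : ℝ) : ℝ := ![0, velocity θ k, -velocity θ k] j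

theorem bandCos_sq_add (hs : Real.sin θ ≠ 0) (k : ℝ) :
    bandCos θ k ^ 2 + 2 * bandSin θ k ^ 2 = 1 := by
  have hw := bandRoot_pos hs k
  have h2 : √2 ^ 2 = 2 := Real.sq_sqrt (by norm_num)
  unfold bandCos bandSin
  field_simp
  linear_combination (-(√2 ^ 2)) * bandRoot_sq θ k + Real.sin θ ^ 2 * (-h2)

@[simp] theorem bandCos_neg (θ k : ℝ) : bandCos θ (-k) = bandCos θ k := by simp [bandCos]

@[simp] theorem bandSin_neg (θ k : ℝ) : bandSin θ (-k) = bandSin θ k := by simp [bandSin]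

theorem continuous_bandCos (hs : Real.sin θ ≠ 0) : Continuous (bandCos θ) :=
  (continuous_bandParam θ).div (continuous_bandRoot θ) fun k => (bandRoot_pos hs k).ne'

theorem continuous_bandSin (hs : Real.sin θ ≠ 0) : Continuous (bandSin θ) :=
  continuous_const.div ((continuous_bandRoot θ).const_mul _)
    fun k => mul_ne_zero (by positivity) (bandRoot_pos hs k).ne'

theorem coin_mulVec (θ : ℝ) (x y z : ℂ) : coin θ *ᵥ ![x, y, z] =
    ![-((1 + (Real.cos θ : ℂ)) / 2) * x + ((Real.sin θ / √2 : ℝ) : ℂ) * y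
        + (1 - (Real.cos θ : ℂ)) / 2 * z,
      ((Real.sin θ / √2 : ℝ) : ℂ) * x + (Real.cos θ : ℂ) * y + ((Real.sin θ / √2 : ℝ) : ℂ) * z,
      (1 - (Real.cos θ : ℂ)) / 2 * x + ((Real.sin θ / √2 : ℝ) : ℂ) * y
        - (1 + (Real.cos θ : ℂ)) / 2 * z] := by
  ext i
  fin_cases i <;> simp [coin, mulVec, dotProduct, Fin.sum_univ_three]
  ring

theorem shiftSymbol_mulVec (k : ℝ) (v : Fin 3 → ℂ) : shiftSymbol k *ᵥ v =
    ![cexp (k * I) * v 0, v 1, cexp (-(k * I)) * v 2] := by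
  ext i
  fin_cases i <;> simp [shiftSymbol, mulVec_diagonal]

/-- The action of three time steps in coordinates, where `(x₁, x₂, x₃)` is the vector after the
first step. -/
theorem threeStep_mulVec (θ k : ℝ) (x y z : ℂ) :
    ∀ x₁ x₂ x₃ : ℂ,
    x₁ = cexp (k * I) * (-((1 + (Real.cos θ : ℂ)) / 2) * x + ((Real.sin θ / √2 : ℝ) : ℂ) * y
        + (1 - (Real.cos θ : ℂ)) / 2 * z) →
    x₂ = ((Real.sin θ / √2 : ℝ) : ℂ) * x + (Real.cos θ : ℂ) * y
        + ((Real.sin θ / √2 : ℝ) : ℂ) * z →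
    x₃ = cexp (-(k * I)) * ((1 - (Real.cos θ : ℂ)) / 2 * x + ((Real.sin θ / √2 : ℝ) : ℂ) * y
        - (1 + (Real.cos θ : ℂ)) / 2 * z) →
    shiftSymbol k *ᵥ (shiftSymbol k *ᵥ (coin θ *ᵥ (shiftSymbol k *ᵥ (coin θ *ᵥ ![x, y, z])))) =
      ![cexp (k * I) ^ 2 * (-((1 + (Real.cos θ : ℂ)) / 2) * x₁
            + ((Real.sin θ / √2 : ℝ) : ℂ) * x₂ + (1 - (Real.cos θ : ℂ)) / 2 * x₃),
        ((Real.sin θ / √2 : ℝ) : ℂ) * x₁ + (Real.cos θ : ℂ) * x₂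
            + ((Real.sin θ / √2 : ℝ) : ℂ) * x₃,
        cexp (-(k * I)) ^ 2 * ((1 - (Real.cos θ : ℂ)) / 2 * x₁
            + ((Real.sin θ / √2 : ℝ) : ℂ) * x₂ - (1 + (Real.cos θ : ℂ)) / 2 * x₃)] := by
  rintro x₁ x₂ x₃ rfl rfl rfl
  rw [coin_mulVec, shiftSymbol_mulVec, shiftSymbol_mulVec, shiftSymbol_mulVec]
  simp only [cons_val]
  rw [coin_mulVec]
  simp only [cons_val, sq, mul_assoc]

theorem ofReal_sin_div_sqrt_two_sq (θ : ℝ) :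
    ((Real.sin θ / √2 : ℝ) : ℂ) ^ 2 = (1 - (Real.cos θ : ℂ) ^ 2) / 2 := by
  have : (Real.sin θ / √2) ^ 2 = (1 - Real.cos θ ^ 2) / 2 := by
    rw [div_pow, Real.sq_sqrt (by norm_num), Real.sin_sq]
  exact_mod_cast this

theorem cexp_mul_cexp_neg (z : ℂ) : cexp z * cexp (-z) = 1 := by
  rw [← Complex.exp_add, add_neg_cancel, Complex.exp_zero]

theorem ofReal_cos_eq (k : ℝ) : (Real.cos k : ℂ) = (cexp (k * I) + cexp (-(k * I))) / 2 := by
  rw [Complex.ofReal_cos, Complex.cos, neg_mul]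

theorem ofReal_sin_mul_I (k : ℝ) :
    (Real.sin k : ℂ) * I = (cexp (k * I) - cexp (-(k * I))) / 2 := by
  rw [Complex.ofReal_sin, Complex.sin, neg_mul]
  linear_combination (-(cexp (k * I) - cexp (-(k * I))) / 2) * I_mul_I

theorem threeStep_flatVector (hs : Real.sin θ ≠ 0) (k : ℝ) :
    shiftSymbol k *ᵥ (shiftSymbol k *ᵥ (coin θ *ᵥ (shiftSymbol k *ᵥ
      (coin θ *ᵥ flatVector θ k)))) = flatVector θ k := by
  have hσ := ofReal_sin_div_sqrt_two_sq θ
  have he := cexp_mul_cexp_neg (k * I)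
  have hz := ofReal_cos_eq k
  have hw := (bandRoot_pos hs k).ne'
  have hq : (bandSin θ k : ℂ) = ((Real.sin θ / √2 : ℝ) : ℂ) * (bandRoot θ k : ℂ)⁻¹ := by
    rw [bandSin, ← div_div]; push_cast; rfl
  have hr : (bandCos θ k : ℂ) = (1 + (1 + (Real.cos θ : ℂ)) * (Real.cos k : ℂ))
      * (bandRoot θ k : ℂ)⁻¹ := by
    rw [bandCos, bandParam]; push_cast; rfl
  rw [flatVector, threeStep_mulVec θ k _ _ _ _ _ _ rfl rfl rfl, hq, hr, hz]
  generalize ((Real.sin θ / √2 : ℝ) : ℂ) = σ at *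
  generalize (Real.cos θ : ℂ) = c at *
  generalize (bandRoot θ k : ℂ)⁻¹ = ι at *
  generalize cexp (k * I) = e at *
  generalize cexp (-(k * I)) = e' at *
  clear hq hr hz
  congr 1
  · grind
  · congr 1
    · grind
    · congr 1
      grind

/-- The symbol of three time steps preserves the plane of the dispersive bands. Action on
the vector `(e^{ik}, 0, -e^{-ik})`. -/
theorem threeStep_odd (c σ e e' : ℂ) (hσ : σ ^ 2 = (1 - c ^ 2) / 2) (he : e * e' = 1)
    (z u T X x₁ x₂ x₃ : ℂ) (hz : z = (e + e') / 2) (hu : u = 1 + (1 + c) * z)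
    (hT : T = (e - e') / 2 * ((1 + c) * z - c))
    (hX : X = 1 - (1 - z) * (u ^ 2 + 2 * σ ^ 2))
    (h1 : x₁ = e * (-((1 + c) / 2) * e + (1 - c) / 2 * (-e')))
    (h2 : x₂ = σ * e + σ * (-e'))
    (h3 : x₃ = e' * ((1 - c) / 2 * e - (1 + c) / 2 * (-e'))) :
    e ^ 2 * (-((1 + c) / 2) * x₁ + σ * x₂ + (1 - c) / 2 * x₃) = X * e - T * (-u * e) ∧
    σ * x₁ + c * x₂ + σ * x₃ = -T * (2 * σ) ∧
    e' ^ 2 * ((1 - c) / 2 * x₁ + σ * x₂ - (1 + c) / 2 * x₃) = X * (-e') - T * (-u * e') := by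
  subst h1 h2 h3 hX hT hu hz
  refine ⟨?_, ?_, ?_⟩ <;> grind

/-- The symbol of three time steps preserves the plane of the dispersive bands. Action on
the vector `(-u e^{ik}, √2 s, -u e^{-ik})`. -/
theorem threeStep_even (c σ e e' : ℂ) (hσ : σ ^ 2 = (1 - c ^ 2) / 2) (he : e * e' = 1)
    (z u T X x₁ x₂ x₃ : ℂ) (hz : z = (e + e') / 2) (hu : u = 1 + (1 + c) * z)
    (hT : T = (e - e') / 2 * ((1 + c) * z - c))
    (hX : X = 1 - (1 - z) * (u ^ 2 + 2 * σ ^ 2))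
    (h1 : x₁ = e * (-((1 + c) / 2) * (-u * e) + σ * (2 * σ) + (1 - c) / 2 * (-u * e')))
    (h2 : x₂ = σ * (-u * e) + c * (2 * σ) + σ * (-u * e'))
    (h3 : x₃ = e' * ((1 - c) / 2 * (-u * e) + σ * (2 * σ) - (1 + c) / 2 * (-u * e'))) :
    e ^ 2 * (-((1 + c) / 2) * x₁ + σ * x₂ + (1 - c) / 2 * x₃) =
      X * (-u * e) - T * (u ^ 2 + 2 * σ ^ 2) * e ∧
    σ * x₁ + c * x₂ + σ * x₃ = X * (2 * σ) ∧
    e' ^ 2 * ((1 - c) / 2 * x₁ + σ * x₂ - (1 + c) / 2 * x₃) =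
      X * (-u * e') - T * (u ^ 2 + 2 * σ ^ 2) * (-e') := by
  subst h1 h2 h3 hX hT hu hz
  refine ⟨?_, ?_, ?_⟩ <;> grind

/-- The band vectors are the combinations
`((e^{ik}, 0, -e^{-ik}) + ε (-u e^{ik}, √2 s, -u e^{-ik}) / w) / 2` of the two vectors of
`threeStep_odd` and `threeStep_even`. -/
theorem threeStep_bandVector (hs : Real.sin θ ≠ 0) {ε : ℝ} (hε : ε ^ 2 = 1) (k : ℝ) :
    shiftSymbol k *ᵥ (shiftSymbol k *ᵥ (coin θ *ᵥ (shiftSymbol k *ᵥ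
      (coin θ *ᵥ bandVector θ ε k)))) = bandValue θ ε k • bandVector θ ε k := by
  have hσ := ofReal_sin_div_sqrt_two_sq θ
  have he := cexp_mul_cexp_neg (k * I)
  have hw := (bandRoot_pos hs k).ne'
  have hε : (ε : ℂ) ^ 2 = 1 := by exact_mod_cast hε
  have hι : (bandRoot θ k : ℂ) * (bandRoot θ k : ℂ)⁻¹ = 1 :=
    mul_inv_cancel₀ (by exact_mod_cast hw)
  have hq : (bandSin θ k : ℂ) = ((Real.sin θ / √2 : ℝ) : ℂ) * (bandRoot θ k : ℂ)⁻¹ := by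
    rw [bandSin, ← div_div]; push_cast; rfl
  have hr : (bandCos θ k : ℂ) = (bandParam θ k : ℂ) * (bandRoot θ k : ℂ)⁻¹ := by
    rw [bandCos]; push_cast; rfl
  have hu : (bandParam θ k : ℂ) = 1 + (1 + (Real.cos θ : ℂ)) * (Real.cos k : ℂ) := by
    rw [bandParam]; push_cast; rfl
  have hw2 : (bandRoot θ k : ℂ) ^ 2 =
      (bandParam θ k : ℂ) ^ 2 + 2 * ((Real.sin θ / √2 : ℝ) : ℂ) ^ 2 := by
    have : bandRoot θ k ^ 2 = bandParam θ k ^ 2 + 2 * (Real.sin θ / √2) ^ 2 := by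
      rw [bandRoot_sq, div_pow, Real.sq_sqrt (by norm_num)]; ring
    exact_mod_cast this
  have hv : bandValue θ ε k = 1 - (1 - (Real.cos k : ℂ)) * (bandRoot θ k : ℂ) ^ 2
      - ε * ((cexp (k * I) - cexp (-(k * I))) / 2
        * ((1 + (Real.cos θ : ℂ)) * (Real.cos k : ℂ) - (Real.cos θ : ℂ)))
        * (bandRoot θ k : ℂ) := by
    rw [bandValue, ← ofReal_sin_mul_I]; push_cast; ring
  obtain ⟨o1, o2, o3⟩ := threeStep_odd _ _ _ _ hσ he _ _ _ _ _ _ _ (ofReal_cos_eq k) hu rfl rfl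
    rfl rfl rfl
  obtain ⟨e1, e2, e3⟩ := threeStep_even _ _ _ _ hσ he _ _ _ _ _ _ _ (ofReal_cos_eq k) hu rfl rfl
    rfl rfl rfl
  rw [hv, hw2]
  rw [← hw2] at e1 e2 e3 o1 o3
  rw [bandVector, threeStep_mulVec θ k _ _ _ _ _ _ rfl rfl rfl, hq, hr, ← hw2]
  generalize ((Real.sin θ / √2 : ℝ) : ℂ) = σ at *
  generalize (Real.cos θ : ℂ) = c at *
  generalize (Real.cos k : ℂ) = z at *
  generalize (bandRoot θ k : ℂ)⁻¹ = ι at *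
  generalize (bandRoot θ k : ℂ) = w at *
  generalize (bandParam θ k : ℂ) = u at *
  generalize (ε : ℂ) = ε at *
  generalize cexp (k * I) = e at *
  generalize cexp (-(k * I)) = e' at *
  simp only [smul_cons, smul_eq_mul, smul_empty]
  clear hσ he hq hr hu hw2 hv
  congr 1
  · linear_combination (1 / 2) * o1 + (ε * ι / 2) * e1
      - 1 / 2 * ((e - e') / 2 * ((1 + c) * z - c)) * e * (u * hε + (u * ε ^ 2 + ε * w) * hι)
  · congr 1
    · linear_combination (1 / 2) * o2 + (ε * ι / 2) * e2
        + (e - e') / 2 * ((1 + c) * z - c) * σ * (hε + ε ^ 2 * hι)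
    · congr 1
      linear_combination (1 / 2) * o3 + (ε * ι / 2) * e3
        - 1 / 2 * ((e - e') / 2 * ((1 + c) * z - c)) * e' * (u * hε + (u * ε ^ 2 - ε * w) * hι)

end Eigensystem

/-! ### Amplitudes and eigenvalues -/

section Amplitudes

open Matrix Complex

variable {θ : ℝ}

theorem star_cexp_mul_I (k : ℝ) : (starRingEnd ℂ) (cexp (k * I)) = cexp (-(k * I)) := by
  rw [← Complex.exp_conj]; simp

theorem star_cexp_neg_mul_I (k : ℝ) : (starRingEnd ℂ) (cexp (-(k * I))) = cexp (k * I) := by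
  rw [← Complex.exp_conj]; simp

/-- The eigenvectors form an orthonormal basis at every wave number, including the wave numbers
at which eigenvalues collide. -/
theorem star_eigenvector_dotProduct (hs : Real.sin θ ≠ 0) (i j : Fin 3) (k : ℝ) :
    star (eigenvector θ i k) ⬝ᵥ eigenvector θ j k = if i = j then 1 else 0 := by
  have he := cexp_mul_cexp_neg (k * I)
  have hrq : (bandCos θ k : ℂ) ^ 2 + 2 * (bandSin θ k : ℂ) ^ 2 = 1 := by
    exact_mod_cast bandCos_sq_add hs k
  fin_cases i <;> fin_cases j <;>
    simp [eigenvector, flatVector, bandVector, dotProduct, Fin.sum_univ_three, star_cexp_mul_I,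
      star_cexp_neg_mul_I, map_ofNat (starRingEnd ℂ) 2] <;>
    generalize cexp (k * I) = e at * <;>
    generalize cexp (-(k * I)) = e' at * <;>
    generalize (bandCos θ k : ℂ) = r at * <;>
    generalize (bandSin θ k : ℂ) = q at * <;>
    grind

/-- The component of a vector along the eigenvector of a band. -/
def amplitude (θ : ℝ) (ψ : Fin 3 → ℂ) (j : Fin 3) (k : ℝ) : ℂ := star (eigenvector θ j k) ⬝ᵥ ψ

theorem sum_amplitude_smul (hs : Real.sin θ ≠ 0) (ψ : Fin 3 → ℂ) (k : ℝ) :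
    ∑ j, amplitude θ ψ j k • eigenvector θ j k = ψ := by
  have h : Matrix.of (fun i j => star (eigenvector θ i k j)) *
      (Matrix.of fun i j => eigenvector θ j k i) = 1 := by
    ext i j
    rw [Matrix.one_apply, ← star_eigenvector_dotProduct hs i j k]
    rfl
  have h' := congrArg (· *ᵥ ψ) (mul_eq_one_comm.1 h)
  simp only [one_mulVec, ← mulVec_mulVec] at h'
  conv_rhs => rw [← h']
  ext i
  simp only [Finset.sum_apply, Pi.smul_apply, smul_eq_mul, mulVec, Matrix.of_apply, amplitude,
    dotProduct, Pi.star_apply]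
  exact Finset.sum_congr rfl fun j _ => mul_comm _ _

theorem continuous_eigenvector (hs : Real.sin θ ≠ 0) (j : Fin 3) :
    Continuous (eigenvector θ j) := by
  have h1 := continuous_bandCos hs
  have h2 := continuous_bandSin hs
  refine continuous_pi fun i => ?_
  fin_cases j <;> fin_cases i <;> simp [eigenvector, flatVector, bandVector] <;> fun_prop

theorem continuous_amplitude (hs : Real.sin θ ≠ 0) (ψ : Fin 3 → ℂ) (j : Fin 3) :
    Continuous (amplitude θ ψ j) := by
  have := continuous_eigenvector hs j
  unfold amplitude dotProduct
  simp only [Pi.star_apply]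
  fun_prop

theorem sum_norm_amplitude_sq (hs : Real.sin θ ≠ 0) (ψ : Fin 3 → ℂ) (k : ℝ) :
    ∑ j, ‖amplitude θ ψ j k‖ ^ 2 = ∑ i, ‖ψ i‖ ^ 2 := by
  have h : star ψ ⬝ᵥ ψ = ∑ j, star (amplitude θ ψ j k) * amplitude θ ψ j k := by
    conv_lhs => rw [← sum_amplitude_smul hs ψ k]
    rw [star_sum, sum_dotProduct]
    refine Finset.sum_congr rfl fun j _ => ?_
    rw [dotProduct_sum, Finset.sum_eq_single j]
    · simp [star_eigenvector_dotProduct hs, star_smul, mul_comm]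
    · intro i _ hij
      simp [star_eigenvector_dotProduct hs, star_smul, hij.symm]
    · simp
  have h2 : ((∑ i, ‖ψ i‖ ^ 2 : ℝ) : ℂ) = ((∑ j, ‖amplitude θ ψ j k‖ ^ 2 : ℝ) : ℂ) := by
    push_cast
    simp only [← Complex.conj_mul']
    exact h
  exact_mod_cast h2.symm

/-- The sum of the squared moduli of a component along a dispersive band at opposite wave numbers
is the quadratic form found in the density. -/
theorem norm_band_component_sq_add (α β γ : ℂ) (k r q : ℝ) (h : r ^ 2 + 2 * q ^ 2 = 1) :
    ‖(1 - r) / 2 * cexp (-(k * I)) * α + q * β - (1 + r) / 2 * cexp (k * I) * γ‖ ^ 2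
      + ‖(1 - r) / 2 * cexp (k * I) * α + q * β - (1 + r) / 2 * cexp (-(k * I)) * γ‖ ^ 2 =
    (1 - r) ^ 2 / 2 * ‖α‖ ^ 2 + 2 * q ^ 2 * ‖β‖ ^ 2 + (1 + r) ^ 2 / 2 * ‖γ‖ ^ 2
        + 2 * q * Real.cos k * (1 - r) * (α * (starRingEnd ℂ) β).re
        - 2 * q * Real.cos k * (1 + r) * (β * (starRingEnd ℂ) γ).re
        - 2 * q ^ 2 * (2 * Real.cos k ^ 2 - 1) * (γ * (starRingEnd ℂ) α).re := by
  have hk := Real.sin_sq_add_cos_sq k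
  have e1 : cexp (k * I) = ⟨Real.cos k, Real.sin k⟩ := by
    apply Complex.ext <;> simp [Complex.exp_ofReal_mul_I_re, Complex.exp_ofReal_mul_I_im]
  have e2 : cexp (-(k * I)) = ⟨Real.cos k, -Real.sin k⟩ := by
    rw [← star_cexp_mul_I, e1]; rfl
  have a1 : ((1 - r) / 2 : ℂ) = (((1 - r) / 2 : ℝ) : ℂ) := by push_cast; rfl
  have a2 : ((1 + r) / 2 : ℂ) = (((1 + r) / 2 : ℝ) : ℂ) := by push_cast; rfl
  rw [e1, e2, a1, a2]
  obtain ⟨α₁, α₂⟩ := α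
  obtain ⟨β₁, β₂⟩ := β
  obtain ⟨γ₁, γ₂⟩ := γ
  simp only [← Complex.normSq_eq_norm_sq, Complex.normSq_apply, Complex.add_re, Complex.add_im,
    Complex.sub_re, Complex.sub_im, Complex.mul_re, Complex.mul_im, Complex.ofReal_re,
    Complex.ofReal_im, Complex.conj_re, Complex.conj_im]
  generalize Real.cos k = z at *
  generalize Real.sin k = y at *
  grind

theorem ν_velocity_eq (hs : Real.sin θ ≠ 0) (α β γ : ℂ) (k : ℝ) :
    ν θ α β γ (velocity θ k) = (5 + 4 * Real.cos θ) ^ 2 *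
      (‖amplitude θ ![α, β, γ] 1 k‖ ^ 2 + ‖amplitude θ ![α, β, γ] 1 (-k)‖ ^ 2) := by
  rw [ν_velocity hs α β γ k (r := bandCos θ k) (q := bandSin θ k) rfl rfl]
  rw [← norm_band_component_sq_add α β γ k _ _ (bandCos_sq_add hs k)]
  congr 4 <;>
  · simp [amplitude, eigenvector, bandVector, dotProduct, Fin.sum_univ_three, star_cexp_mul_I,
      star_cexp_neg_mul_I, map_ofNat (starRingEnd ℂ) 2]
    ring

/-- Up to a sign, reversing the order of the entries and the sign of the wave number exchanges the
two dispersive bands, so the band of velocity `-h` is governed by `ν` with `α` and `γ` exchanged. -/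
theorem ν_velocity_eq_swap (hs : Real.sin θ ≠ 0) (α β γ : ℂ) (k : ℝ) :
    ν θ γ β α (velocity θ k) = (5 + 4 * Real.cos θ) ^ 2 *
      (‖amplitude θ ![α, β, γ] 2 k‖ ^ 2 + ‖amplitude θ ![α, β, γ] 2 (-k)‖ ^ 2) := by
  rw [ν_velocity hs γ β α k (r := bandCos θ k) (q := bandSin θ k) rfl rfl]
  rw [← norm_band_component_sq_add γ β α k _ _ (bandCos_sq_add hs k),
    add_comm (‖amplitude θ ![α, β, γ] 2 k‖ ^ 2)]
  congr 3 <;>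
  · rw [← norm_neg]
    congr 1
    simp [amplitude, eigenvector, bandVector, dotProduct, Fin.sum_univ_three, star_cexp_mul_I,
      star_cexp_neg_mul_I, map_ofNat (starRingEnd ℂ) 2]
    ring

theorem norm_bandValue {ε : ℝ} (hε : ε ^ 2 = 1) (k : ℝ) : ‖bandValue θ ε k‖ = 1 := by
  have h1 : ‖bandValue θ ε k‖ ^ 2 = 1 := by
    have hw := bandRoot_sq θ k
    have hu : bandParam θ k = 1 + (1 + Real.cos θ) * Real.cos k := rfl
    have hk := Real.sin_sq_add_cos_sq k
    have hθ := Real.sin_sq_add_cos_sq θ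
    rw [← Complex.normSq_eq_norm_sq, Complex.normSq_apply, bandValue]
    simp only [Complex.sub_re, Complex.sub_im, Complex.mul_re, Complex.mul_im, Complex.ofReal_re,
      Complex.ofReal_im, Complex.I_re, Complex.I_im]
    rw [hu] at hw
    generalize bandRoot θ k = w at *
    generalize Real.cos k = z at *
    generalize Real.sin k = y at *
    generalize Real.cos θ = c at *
    generalize Real.sin θ = s at *
    clear hu
    -- With the eigenvalue `X - iεY`, the two summands are `1 - X` and `1 + X`.
    have : (1 - z) * w ^ 2 + (1 + z) * ((1 + c) * z - c) ^ 2 = 2 := by grind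
    have hy : y ^ 2 = (1 - z) * (1 + z) := by linarith
    linear_combination (1 - z) * w ^ 2 * this + ((1 + c) * z - c) ^ 2 * w ^ 2 * ε ^ 2 * hy
      + ((1 + c) * z - c) ^ 2 * w ^ 2 * (1 - z) * (1 + z) * hε
  have h2 := norm_nonneg (bandValue θ ε k)
  nlinarith

theorem norm_eigenvalue (θ : ℝ) (j : Fin 3) (k : ℝ) : ‖eigenvalue θ j k‖ = 1 := by
  fin_cases j
  · simp [eigenvalue]
  · exact norm_bandValue (by norm_num) k
  · exact norm_bandValue (by norm_num) k

/-- The logarithmic derivative of the eigenvalue of three time steps is, up to the factor `-i`,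
three times the velocity. -/
theorem hasDerivAt_bandValue (hs : Real.sin θ ≠ 0) {ε : ℝ} (hε : ε ^ 2 = 1) (k : ℝ) :
    HasDerivAt (bandValue θ ε) (-(3 * (ε * velocity θ k : ℝ)) * I * bandValue θ ε k) k := by
  have hw := (bandRoot_pos hs k).ne'
  have hX : HasDerivAt (fun k => 1 - (1 - Real.cos k) * bandRoot θ k ^ 2)
      (-(3 * velocity θ k * (Real.sin k * ((1 + Real.cos θ) * Real.cos k - Real.cos θ)
        * bandRoot θ k))) k := by
    have h := (((Real.hasDerivAt_cos k).const_sub 1).mul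
      ((hasDerivAt_bandRoot hs k).pow 2)).const_sub 1
    refine h.congr_deriv ?_
    have h2 := bandRoot_sq θ k
    have hu : bandParam θ k = 1 + (1 + Real.cos θ) * Real.cos k := rfl
    have hθ := Real.sin_sq_add_cos_sq θ
    simp only [Pi.pow_apply, velocity]
    field_simp
    rw [hu] at h2 ⊢
    generalize bandRoot θ k = w at *
    generalize Real.cos k = z at *
    generalize Real.sin k = y at *
    generalize Real.cos θ = c at *
    generalize Real.sin θ = s at *
    clear hu h
    push_cast
    grind
  have hY : HasDerivAt (fun k => Real.sin k * ((1 + Real.cos θ) * Real.cos k - Real.cos θ)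
        * bandRoot θ k)
      (3 * velocity θ k * (1 - (1 - Real.cos k) * bandRoot θ k ^ 2)) k := by
    have h := ((Real.hasDerivAt_sin k).mul
      (((Real.hasDerivAt_cos k).const_mul (1 + Real.cos θ)).sub_const (Real.cos θ))).mul
      (hasDerivAt_bandRoot hs k)
    refine h.congr_deriv ?_
    have h2 := bandRoot_sq θ k
    have hu : bandParam θ k = 1 + (1 + Real.cos θ) * Real.cos k := rfl
    have hθ := Real.sin_sq_add_cos_sq θ
    have hk := Real.sin_sq_add_cos_sq k
    simp only [velocity, Pi.mul_apply]
    field_simp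
    rw [hu] at h2 ⊢
    generalize bandRoot θ k = w at *
    generalize Real.cos k = z at *
    generalize Real.sin k = y at *
    generalize Real.cos θ = c at *
    generalize Real.sin θ = s at *
    clear hu h
    grind
  have h := hX.ofReal_comp.sub ((hY.ofReal_comp.const_mul (ε : ℂ)).mul_const I)
  refine h.congr_deriv ?_
  have hε : (ε : ℂ) ^ 2 = 1 := by exact_mod_cast hε
  unfold bandValue
  simp only [Complex.ofReal_neg, Complex.ofReal_mul, Complex.ofReal_sub, Complex.ofReal_add,
    Complex.ofReal_one, Complex.ofReal_pow, Complex.ofReal_ofNat]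
  linear_combination (-(3 * (velocity θ k : ℂ) * (Real.sin k * ((1 + Real.cos θ) * Real.cos k
    - Real.cos θ) * bandRoot θ k))) * (ε ^ 2 * I_mul_I - hε)

theorem hasDerivAt_eigenvalue (hs : Real.sin θ ≠ 0) (j : Fin 3) (k : ℝ) :
    HasDerivAt (eigenvalue θ j) (-(3 * bandVelocity θ j k) * I * eigenvalue θ j k) k := by
  fin_cases j
  · exact (hasDerivAt_const k (1 : ℂ)).congr_deriv (by simp [bandVelocity])
  · exact (hasDerivAt_bandValue hs (ε := 1) (by norm_num) k).congr_deriv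
      (by simp [bandVelocity, eigenvalue])
  · exact (hasDerivAt_bandValue hs (ε := -1) (by norm_num) k).congr_deriv
      (by simp [bandVelocity, eigenvalue])

theorem threeStep_eigenvector (hs : Real.sin θ ≠ 0) (j : Fin 3) (k : ℝ) :
    shiftSymbol k *ᵥ (shiftSymbol k *ᵥ (coin θ *ᵥ (shiftSymbol k *ᵥ
      (coin θ *ᵥ eigenvector θ j k)))) = eigenvalue θ j k • eigenvector θ j k := by
  fin_cases j
  · simpa [eigenvalue, eigenvector] using threeStep_flatVector hs k
  · simpa [eigenvalue, eigenvector] using threeStep_bandVector hs (ε := 1) (by norm_num) k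
  · simpa [eigenvalue, eigenvector] using threeStep_bandVector hs (ε := -1) (by norm_num) k

theorem continuous_bandVelocity (hs : Real.sin θ ≠ 0) (j : Fin 3) :
    Continuous (bandVelocity θ j) := by
  fin_cases j
  · exact continuous_const
  · exact continuous_velocity hs
  · exact (continuous_velocity hs).neg

end Amplitudes

/-! ### Fourier representation of the walk -/

section TrigonometricSums

open Complex

/-- The Fourier series `∑ₓ e^{-ikx} a(x)` of a sequence. -/
def fourierSum (a : ℤ → ℂ) (k : ℝ) : ℂ := ∑' x : ℤ, cexp (-(k * x * I)) * a x

theorem fourierSum_add_one (a : ℤ → ℂ) (k : ℝ) :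
    fourierSum (fun x => a (x + 1)) k = cexp (k * I) * fourierSum a k := by
  unfold fourierSum
  rw [← (Equiv.addRight (1 : ℤ)).tsum_eq fun x : ℤ => cexp (-(k * x * I)) * a x, ← tsum_mul_left]
  refine tsum_congr fun x => ?_
  rw [Equiv.coe_addRight, ← mul_assoc, ← Complex.exp_add]
  congr 2
  push_cast
  ring

theorem fourierSum_sub_one (a : ℤ → ℂ) (k : ℝ) :
    fourierSum (fun x => a (x - 1)) k = cexp (-(k * I)) * fourierSum a k := by
  unfold fourierSum
  rw [← (Equiv.subRight (1 : ℤ)).tsum_eq fun x : ℤ => cexp (-(k * x * I)) * a x, ← tsum_mul_left]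
  refine tsum_congr fun x => ?_
  rw [Equiv.subRight_apply, ← mul_assoc, ← Complex.exp_add]
  congr 2
  push_cast
  ring

theorem fourierSum_eq_sum {a : ℤ → ℂ} {s : Finset ℤ} (ha : ∀ x ∉ s, a x = 0) (k : ℝ) :
    fourierSum a k = ∑ x ∈ s, cexp (-(k * x * I)) * a x :=
  tsum_eq_sum fun x hx => by rw [ha x hx, mul_zero]

theorem integral_cexp_int_mul_I (n : ℤ) :
    ∫ k in -Real.pi..Real.pi, cexp (k * n * I) =
      if n = 0 then (2 * Real.pi : ℂ) else 0 := by
  split_ifs with h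
  · simp only [h, Int.cast_zero, mul_zero, zero_mul, Complex.exp_zero,
      intervalIntegral.integral_const, sub_neg_eq_add]
    rw [Complex.real_smul]
    push_cast
    ring
  · have hn : (n : ℂ) * I ≠ 0 := mul_ne_zero (by exact_mod_cast h) I_ne_zero
    have := integral_exp_mul_complex (a := -Real.pi) (b := Real.pi) hn
    have e : ∀ x : ℝ, cexp (x * n * I) = cexp (n * I * x) := fun x => by ring_nf
    simp only [e]
    rw [this, div_eq_zero_iff, sub_eq_zero]
    left
    rw [Complex.exp_eq_exp_iff_exists_int]
    exact ⟨n, by push_cast; ring⟩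

/-- Parseval's identity for a finitely supported sequence and its modulation: a shift of the wave
number by `η` multiplies the sequence by `e^{iηx}`. -/
theorem integral_conj_fourierSum_mul {a : ℤ → ℂ} {s : Finset ℤ} (ha : ∀ x ∉ s, a x = 0) (η : ℝ) :
    ∫ k in -Real.pi..Real.pi, (starRingEnd ℂ) (fourierSum a k) * fourierSum a (k - η) =
      2 * Real.pi * ∑ x ∈ s, (‖a x‖ ^ 2 : ℝ) * cexp (η * x * I) := by
  have h : ∀ k : ℝ, (starRingEnd ℂ) (fourierSum a k) * fourierSum a (k - η) =
      ∑ x ∈ s, ∑ y ∈ s, (starRingEnd ℂ) (a x) * a y * cexp (η * y * I)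
        * cexp (k * (x - y : ℤ) * I) := by
    intro k
    rw [fourierSum_eq_sum ha, fourierSum_eq_sum ha, map_sum, Finset.sum_mul_sum]
    refine Finset.sum_congr rfl fun x _ => Finset.sum_congr rfl fun y _ => ?_
    have e1 : (starRingEnd ℂ) (cexp (-(k * x * I))) = cexp (k * x * I) := by
      rw [← Complex.exp_conj]; simp
    have e2 : cexp (-((k - η : ℝ) * y * I)) = cexp (η * y * I) * cexp (-(k * y * I)) := by
      rw [← Complex.exp_add]; congr 1; push_cast; ring
    have e3 : cexp (k * (x - y : ℤ) * I) = cexp (k * x * I) * cexp (-(k * y * I)) := by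
      rw [← Complex.exp_add]; congr 1; push_cast; ring
    rw [map_mul, e1, e2, e3]
    ring
  simp only [h]
  rw [intervalIntegral.integral_finsetSum
    fun x _ => Continuous.intervalIntegrable (by fun_prop) _ _, Finset.mul_sum]
  refine Finset.sum_congr rfl fun x hx => ?_
  rw [intervalIntegral.integral_finsetSum
    fun y _ => Continuous.intervalIntegrable (by fun_prop) _ _, Finset.sum_eq_single x]
  · rw [intervalIntegral.integral_const_mul, integral_cexp_int_mul_I, if_pos (sub_self x)]
    push_cast
    rw [← Complex.conj_mul']
    ring
  · intro y _ hy
    rw [intervalIntegral.integral_const_mul, integral_cexp_int_mul_I,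
      if_neg (sub_ne_zero.2 hy.symm), mul_zero]
  · exact fun h => absurd hx h

end TrigonometricSums

section FourierState

open Matrix Complex

variable {θ : ℝ} {α β γ : ℂ}

theorem state_eq_zero (θ : ℝ) (α β γ : ℂ) (t : ℕ) :
    ∀ x ∉ Finset.Icc (-(t : ℤ)) t, state θ α β γ t x = 0 := by
  induction t with
  | zero =>
    intro x hx
    have : x ≠ 0 := by rintro rfl; simp at hx
    simp [state, this]
  | succ t ih =>
    intro x hx
    have h0 : state θ α β γ t x = 0 := ih x (by simp at hx ⊢; omega)
    have h1 : state θ α β γ t (x + 1) = 0 := ih _ (by simp at hx ⊢; omega)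
    have h2 : state θ α β γ t (x - 1) = 0 := ih _ (by simp at hx ⊢; omega)
    ext j
    rw [state]
    split_ifs <;> fin_cases j <;> simp [shift, coinFlip, h0, h1, h2]

/-- The state at time `t` in the wave-number representation. -/
def fourierState (θ : ℝ) (α β γ : ℂ) (t : ℕ) (k : ℝ) : Fin 3 → ℂ :=
  fun j => fourierSum (fun x => state θ α β γ t x j) k

theorem fourierState_zero (θ : ℝ) (α β γ : ℂ) (k : ℝ) :
    fourierState θ α β γ 0 k = ![α, β, γ] := by
  ext j
  rw [fourierState, fourierSum, tsum_eq_single 0]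
  · simp [state]
  · intro x hx
    simp [state, hx]

theorem fourierSum_coinFlip (θ : ℝ) {Ψ : ℤ → Fin 3 → ℂ} {s : Finset ℤ} (hΨ : ∀ x ∉ s, Ψ x = 0)
    (k : ℝ) (j : Fin 3) : fourierSum (fun x => coinFlip θ Ψ x j) k =
      (coin θ *ᵥ fun i => fourierSum (fun x => Ψ x i) k) j := by
  have h : ∀ i, fourierSum (fun x => Ψ x i) k = ∑ x ∈ s, cexp (-(k * x * I)) * Ψ x i :=
    fun i => fourierSum_eq_sum (fun x hx => by simp [hΨ x hx]) k
  rw [fourierSum_eq_sum (a := fun x => coinFlip θ Ψ x j) (s := s)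
    fun x hx => by simp [coinFlip, hΨ x hx]]
  simp only [mulVec, dotProduct, h, Finset.mul_sum]
  rw [Finset.sum_comm]
  refine Finset.sum_congr rfl fun x _ => ?_
  change cexp _ * ∑ i, coin θ j i * Ψ x i = _
  rw [Finset.mul_sum]
  exact Finset.sum_congr rfl fun i _ => by ring

theorem fourierSum_shift (Ψ : ℤ → Fin 3 → ℂ) (k : ℝ) :
    (fun j => fourierSum (fun x => shift Ψ x j) k) =
      shiftSymbol k *ᵥ fun j => fourierSum (fun x => Ψ x j) k := by
  rw [shiftSymbol_mulVec, ← fourierSum_add_one, ← fourierSum_sub_one]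
  ext j
  fin_cases j <;> rfl

theorem fourierState_succ (θ : ℝ) (α β γ : ℂ) (t : ℕ) (k : ℝ) :
    fourierState θ α β γ (t + 1) k =
      if t % 3 = 2 then shiftSymbol k *ᵥ fourierState θ α β γ t k
      else shiftSymbol k *ᵥ (coin θ *ᵥ fourierState θ α β γ t k) := by
  unfold fourierState
  split_ifs with h
  · simp only [state, if_pos h]
    exact fourierSum_shift _ k
  · simp only [state, if_neg h]
    rw [fourierSum_shift]
    congr 1
    ext j
    exact fourierSum_coinFlip θ (state_eq_zero θ α β γ t) k j

theorem continuous_shiftSymbol : Continuous shiftSymbol := by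
  unfold shiftSymbol
  refine Continuous.matrix_diagonal (continuous_pi fun i => ?_)
  fin_cases i <;> simp <;> fun_prop

theorem continuous_fourierState (θ : ℝ) (α β γ : ℂ) (t : ℕ) :
    Continuous (fourierState θ α β γ t) := by
  induction t with
  | zero => simpa only [funext (fourierState_zero θ α β γ)] using continuous_const
  | succ t ih =>
    rw [funext (fourierState_succ θ α β γ t)]
    split_ifs
    · exact continuous_shiftSymbol.matrix_mulVec ih
    · exact continuous_shiftSymbol.matrix_mulVec (continuous_const.matrix_mulVec ih)

theorem star_shiftSymbol_mulVec_dotProduct (k : ℝ) (v w : Fin 3 → ℂ) :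
    star (shiftSymbol k *ᵥ v) ⬝ᵥ (shiftSymbol k *ᵥ w) = star v ⬝ᵥ w := by
  have he := cexp_mul_cexp_neg (k * I)
  rw [shiftSymbol_mulVec, shiftSymbol_mulVec]
  simp [dotProduct, Fin.sum_univ_three, star_cexp_mul_I, star_cexp_neg_mul_I]
  linear_combination ((starRingEnd ℂ) (v 0) * w 0 + (starRingEnd ℂ) (v 2) * w 2) * he

theorem star_coin_mulVec_dotProduct (θ : ℝ) (v w : Fin 3 → ℂ) :
    star (coin θ *ᵥ v) ⬝ᵥ (coin θ *ᵥ w) = star v ⬝ᵥ w := by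
  have hσ := ofReal_sin_div_sqrt_two_sq θ
  have h : ∀ v : Fin 3 → ℂ, v = ![v 0, v 1, v 2] := by
    intro v; ext i; fin_cases i <;> rfl
  rw [h v, h w, coin_mulVec, coin_mulVec]
  simp only [dotProduct, Fin.sum_univ_three, Pi.star_apply, cons_val, RCLike.star_def,
    Complex.conj_ofReal, map_div₀, map_add, map_sub, map_mul, map_neg, map_one,
    map_ofNat (starRingEnd ℂ) 2]
  generalize ((Real.sin θ / √2 : ℝ) : ℂ) = σ at *
  generalize (Real.cos θ : ℂ) = c at *
  grind

theorem sum_norm_fourierState_sq (θ : ℝ) (α β γ : ℂ) (t : ℕ) (k : ℝ) :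
    ∑ j, ‖fourierState θ α β γ t k j‖ ^ 2 = ‖α‖ ^ 2 + ‖β‖ ^ 2 + ‖γ‖ ^ 2 := by
  have h : star (fourierState θ α β γ t k) ⬝ᵥ fourierState θ α β γ t k =
      star ![α, β, γ] ⬝ᵥ ![α, β, γ] := by
    induction t with
    | zero => rw [fourierState_zero]
    | succ t ih =>
      rw [fourierState_succ]
      split_ifs
      · rw [star_shiftSymbol_mulVec_dotProduct, ih]
      · rw [star_shiftSymbol_mulVec_dotProduct, star_coin_mulVec_dotProduct, ih]
  simp only [dotProduct, Fin.sum_univ_three, Pi.star_apply, RCLike.star_def, cons_val,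
    Complex.conj_mul'] at h
  rw [Fin.sum_univ_three]
  exact_mod_cast h

theorem norm_star_dotProduct_le (v w : Fin 3 → ℂ) :
    ‖star v ⬝ᵥ w‖ ≤ (∑ j, ‖v j‖ ^ 2 + ∑ j, ‖w j‖ ^ 2) / 2 := by
  rw [← Finset.sum_add_distrib, Finset.sum_div]
  refine (norm_sum_le _ _).trans (Finset.sum_le_sum fun j _ => ?_)
  rw [norm_mul, Pi.star_apply, norm_star]
  nlinarith [sq_nonneg (‖v j‖ - ‖w j‖)]

/-- The characteristic function of `X_t / t` in the wave-number representation. -/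
theorem charFun_rescaledLaw (h : ‖α‖ ^ 2 + ‖β‖ ^ 2 + ‖γ‖ ^ 2 = 1) (t : ℕ) (ξ : ℝ) :
    charFun (rescaledLaw θ α β γ t) ξ = (2 * Real.pi : ℂ)⁻¹ * ∫ k in -Real.pi..Real.pi,
      star (fourierState θ α β γ t k) ⬝ᵥ fourierState θ α β γ t (k - ξ / t) := by
  have := isProbabilityMeasure_positionLaw θ α β γ h t
  have hsing : ∀ x : ℤ, (positionLaw θ α β γ t).real {x} = prob θ α β γ t x := by
    intro x
    have h0 : 0 ≤ prob θ α β γ t x := Finset.sum_nonneg fun _ _ => by positivity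
    rw [measureReal_def, positionLaw, Measure.sum_apply _ (measurableSet_singleton x),
      tsum_eq_single x]
    · simp [h0]
    · intro y hy
      simp [hy]
  have h1 : charFun (rescaledLaw θ α β γ t) ξ =
      ∑ x ∈ Finset.Icc (-(t : ℤ)) t, (prob θ α β γ t x : ℂ) * cexp ((ξ / t : ℝ) * x * I) := by
    rw [charFun_apply_real, rescaledLaw, integral_map (by fun_prop) (by fun_prop),
      integral_countable]
    · rw [tsum_eq_sum (s := Finset.Icc (-(t : ℤ)) t)]
      · refine Finset.sum_congr rfl fun x _ => ?_
        rw [hsing, Complex.real_smul]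
        congr 2
        push_cast
        ring
      · intro x hx
        rw [hsing]
        simp [prob, state_eq_zero θ α β γ t x hx]
    · refine Integrable.of_bound (C := 1) (Measurable.of_discrete.aestronglyMeasurable)
        (Eventually.of_forall fun x => ?_)
      rw [← Complex.ofReal_mul, Complex.norm_exp_ofReal_mul_I]
  rw [h1]
  simp only [dotProduct, Pi.star_apply, RCLike.star_def]
  have hc : ∀ j, Continuous fun k => fourierState θ α β γ t k j :=
    fun j => (continuous_apply j).comp (continuous_fourierState θ α β γ t)
  have hi : ∀ j ∈ Finset.univ, IntervalIntegrable (fun k =>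
      (starRingEnd ℂ) (fourierState θ α β γ t k j) * fourierState θ α β γ t (k - ξ / t) j)
      volume (-Real.pi) Real.pi := fun j _ => Continuous.intervalIntegrable
    ((Complex.continuous_conj.comp (hc j)).mul ((hc j).comp (continuous_sub_right _))) _ _
  rw [intervalIntegral.integral_finsetSum hi]
  have h2 : ∀ j, ∫ k in -Real.pi..Real.pi, (starRingEnd ℂ) (fourierState θ α β γ t k j)
      * fourierState θ α β γ t (k - ξ / t) j = _ := fun j => integral_conj_fourierSum_mul
        (fun x hx => congrFun (state_eq_zero θ α β γ t x hx) j) (ξ / t)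
  rw [Finset.sum_congr rfl fun j _ => h2 j, ← Finset.mul_sum, ← mul_assoc,
    inv_mul_cancel₀ (by simp), one_mul, Finset.sum_comm]
  refine Finset.sum_congr rfl fun x _ => ?_
  rw [← Finset.sum_mul, prob]
  push_cast
  rfl

end FourierState

/-! ### Long-time asymptotics of the characteristic function -/

section LongTime

open Matrix Complex

variable {θ : ℝ} {α β γ : ℂ}

/-- The state reached from the eigenvector of a band by `r` steps with coin flip. -/
def modeVector (θ : ℝ) (j : Fin 3) : ℕ → ℝ → Fin 3 → ℂ
  | 0, k => eigenvector θ j k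
  | r + 1, k => shiftSymbol k *ᵥ (coin θ *ᵥ modeVector θ j r k)

theorem star_modeVector_dotProduct (hs : Real.sin θ ≠ 0) (i j : Fin 3) (r : ℕ) (k : ℝ) :
    star (modeVector θ i r k) ⬝ᵥ modeVector θ j r k = if i = j then 1 else 0 := by
  induction r with
  | zero => exact star_eigenvector_dotProduct hs i j k
  | succ r ih =>
    rw [modeVector, modeVector, star_shiftSymbol_mulVec_dotProduct, star_coin_mulVec_dotProduct, ih]

theorem continuous_modeVector (hs : Real.sin θ ≠ 0) (j : Fin 3) (r : ℕ) :
    Continuous (modeVector θ j r) := by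
  induction r with
  | zero => exact continuous_eigenvector hs j
  | succ r ih =>
    exact continuous_shiftSymbol.matrix_mulVec (continuous_const.matrix_mulVec ih)

/-- Expansion of the state in the modes: a full period of three steps multiplies a mode by its
eigenvalue. -/
theorem fourierState_eq_sum (hs : Real.sin θ ≠ 0) (α β γ : ℂ) (t : ℕ) (k : ℝ) :
    fourierState θ α β γ t k = ∑ j, (eigenvalue θ j k ^ (t / 3) * amplitude θ ![α, β, γ] j k) •
      modeVector θ j (t % 3) k := by
  induction t with
  | zero =>
    rw [fourierState_zero]
    simpa [modeVector] using (sum_amplitude_smul hs ![α, β, γ] k).symm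
  | succ t ih =>
    rw [fourierState_succ, ih]
    split_ifs with h
    · have h1 : (t + 1) % 3 = 0 := by omega
      have h2 : (t + 1) / 3 = t / 3 + 1 := by omega
      rw [h, h1, h2, mulVec_sum]
      refine Finset.sum_congr rfl fun j _ => ?_
      simp only [modeVector]
      rw [mulVec_smul, threeStep_eigenvector hs, smul_smul, pow_succ]
      congr 1
      ring
    · have h1 : (t + 1) % 3 = t % 3 + 1 := by omega
      have h2 : (t + 1) / 3 = t / 3 := by omega
      rw [h1, h2, mulVec_sum, mulVec_sum]
      refine Finset.sum_congr rfl fun j _ => ?_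
      rw [mulVec_smul, mulVec_smul, modeVector]

theorem tendsto_natCast_div_three : Tendsto (fun t : ℕ => ((t / 3 : ℕ) : ℝ) / t) atTop
    (𝓝 (1 / 3)) := by
  have h := (tendsto_nat_floor_mul_div_atTop (R := ℝ) (a := 1 / 3) (by norm_num)).comp
    (tendsto_natCast_atTop_atTop (R := ℝ))
  refine h.congr fun t => ?_
  have : ⌊(1 / 3 : ℝ) * t⌋₊ = t / 3 := by
    rw [one_div_mul_eq_div]
    exact (Nat.floor_div_ofNat (t : ℝ) 3).trans (by rw [Nat.floor_natCast])
  simp only [Function.comp_apply, this]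

/-- Powers of a differentiable function near a point where it takes the value `1` are asymptotically
exponential. -/
theorem tendsto_pow_of_hasDerivAt {L : ℝ → ℂ} {l : ℂ} {k : ℝ} (hL : HasDerivAt L l k)
    (h1 : L k = 1) (ξ : ℝ) :
    Tendsto (fun t : ℕ => L (k - ξ / t) ^ (t / 3)) atTop (𝓝 (cexp (-(ξ * l / 3)))) := by
  -- Near `k` the values of `L` are close to `1`, hence `L ^ n = exp (n log L)`
  -- with the principal branch, which is differentiable there.
  have hlog : HasDerivAt (fun x => Complex.log (L x)) l k := by
    simpa [h1] using hL.clog_real (by simp [h1])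
  have hN : HasDerivAt (fun s : ℝ => Complex.log (L (k - ξ * s))) (-(ξ * l)) 0 := by
    have hin : HasDerivAt (fun s : ℝ => k - ξ * s) (-ξ) 0 := by
      simpa using ((hasDerivAt_id (0 : ℝ)).const_mul ξ).const_sub k
    have := HasDerivAt.scomp (0 : ℝ) (h := fun s : ℝ => k - ξ * s) (h' := -ξ)
      (g₁ := fun x => Complex.log (L x)) (g₁' := l) (by simpa using hlog) hin
    refine this.congr_deriv ?_
    simp
  have hinv : Tendsto (fun t : ℕ => ((t : ℝ))⁻¹) atTop (𝓝[≠] 0) :=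
    (tendsto_inv_atTop_nhdsGT_zero.comp tendsto_natCast_atTop_atTop).mono_right
      (nhdsWithin_mono _ fun x hx => ne_of_gt hx)
  have hslope := (hasDerivAt_iff_tendsto_slope_zero.1 hN).comp hinv
  have hlim : Tendsto (fun t : ℕ => ((t / 3 : ℕ) : ℂ) * Complex.log (L (k - ξ / t))) atTop
      (𝓝 (-(ξ * l / 3))) := by
    have h3 := (Complex.continuous_ofReal.tendsto _).comp tendsto_natCast_div_three
    have := h3.mul hslope
    rw [show ((1 / 3 : ℝ) : ℂ) * (-(ξ * l)) = -(ξ * l / 3) by push_cast; ring] at this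
    refine this.congr' ?_
    filter_upwards [eventually_gt_atTop 0] with t ht
    have ht' : (t : ℂ) ≠ 0 := by exact_mod_cast ht.ne'
    simp only [Function.comp_apply, inv_inv, zero_add, mul_zero, sub_zero, h1, Complex.log_one,
      Complex.real_smul]
    rw [← div_eq_mul_inv]
    push_cast
    field_simp
  have hne : ∀ᶠ t : ℕ in atTop, L (k - ξ / t) ≠ 0 := by
    have hk : Tendsto (fun t : ℕ => k - ξ / (t : ℝ)) atTop (𝓝 k) := by
      simpa using (tendsto_const_div_atTop_nhds_zero_nat ξ).const_sub k
    have hc := hL.continuousAt.tendsto.comp hk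
    rw [h1] at hc
    exact hc.eventually_ne one_ne_zero
  refine ((Complex.continuous_exp.tendsto _).comp hlim).congr' ?_
  filter_upwards [hne] with t ht
  rw [Function.comp_apply, Complex.exp_nat_mul, Complex.exp_log ht]

theorem tendsto_comp_mod {X : Type*} [TopologicalSpace X] {n : ℕ} (hn : 0 < n) {g : ℕ → ℕ → X}
    {x : X} (h : ∀ r, Tendsto (g r) atTop (𝓝 x)) :
    Tendsto (fun t => g (t % n) t) atTop (𝓝 x) := by
  intro s hs
  have : ∀ᶠ t in atTop, ∀ r ∈ Finset.range n, g r t ∈ s :=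
    (Finset.eventually_all _).2 fun r _ => h r hs
  rw [mem_map]
  filter_upwards [this] with t ht
  exact ht _ (Finset.mem_range.2 (Nat.mod_lt _ hn))

/-- In the wave-number representation, a shift of the wave number by `ξ / t` asymptotically
multiplies each band by the phase `e^{iξh}` given by its velocity `h`, and the interference between
distinct bands vanishes by orthogonality. -/
theorem tendsto_star_fourierState_dotProduct (hs : Real.sin θ ≠ 0) (α β γ : ℂ) (k ξ : ℝ) :
    Tendsto (fun t : ℕ => star (fourierState θ α β γ t k) ⬝ᵥ fourierState θ α β γ t (k - ξ / t))
      atTop (𝓝 (∑ j, cexp (ξ * bandVelocity θ j k * I)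
        * (‖amplitude θ ![α, β, γ] j k‖ ^ 2 : ℝ))) := by
  set ψ := ![α, β, γ]
  have hk : Tendsto (fun t : ℕ => k - ξ / (t : ℝ)) atTop (𝓝 k) := by
    simpa using (tendsto_const_div_atTop_nhds_zero_nat ξ).const_sub k
  have hexp : ∀ t : ℕ,
      star (fourierState θ α β γ t k) ⬝ᵥ fourierState θ α β γ t (k - ξ / t) =
      ∑ i, ∑ j, ((starRingEnd ℂ) (eigenvalue θ i k) * eigenvalue θ j (k - ξ / t)) ^ (t / 3) *
        ((starRingEnd ℂ) (amplitude θ ψ i k) * amplitude θ ψ j (k - ξ / t) *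
        (star (modeVector θ i (t % 3) k) ⬝ᵥ modeVector θ j (t % 3) (k - ξ / t))) := by
    intro t
    rw [fourierState_eq_sum hs, fourierState_eq_sum hs, star_sum, sum_dotProduct]
    refine Finset.sum_congr rfl fun i _ => ?_
    rw [dotProduct_sum]
    refine Finset.sum_congr rfl fun j _ => ?_
    rw [star_smul, smul_dotProduct, dotProduct_smul, smul_eq_mul, smul_eq_mul, RCLike.star_def,
      map_mul, map_pow, mul_pow]
    ring
  have hrest : ∀ i j, Tendsto (fun t : ℕ =>
      (starRingEnd ℂ) (amplitude θ ψ i k) * amplitude θ ψ j (k - ξ / t) *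
        (star (modeVector θ i (t % 3) k) ⬝ᵥ modeVector θ j (t % 3) (k - ξ / t))) atTop
      (𝓝 ((starRingEnd ℂ) (amplitude θ ψ i k) * amplitude θ ψ j k * if i = j then 1 else 0)) := by
    intro i j
    refine Tendsto.mul (tendsto_const_nhds.mul
      (((continuous_amplitude hs ψ j).tendsto k).comp hk)) ?_
    refine tendsto_comp_mod (by norm_num) (g := fun r t =>
      star (modeVector θ i r k) ⬝ᵥ modeVector θ j r (k - ξ / t)) fun r => ?_
    rw [← star_modeVector_dotProduct hs i j r k]
    have hc : Continuous fun k' => star (modeVector θ i r k) ⬝ᵥ modeVector θ j r k' :=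
      continuous_const.dotProduct (continuous_modeVector hs j r)
    exact (hc.tendsto k).comp hk
  simp only [hexp]
  refine tendsto_finsetSum _ fun i _ => ?_
  rw [show cexp (ξ * bandVelocity θ i k * I) * (‖amplitude θ ψ i k‖ ^ 2 : ℝ) =
      ∑ j, if i = j then cexp (ξ * bandVelocity θ i k * I) * (‖amplitude θ ψ i k‖ ^ 2 : ℝ) else 0
    by rw [Finset.sum_ite_eq]; simp]
  refine tendsto_finsetSum _ fun j _ => ?_
  split_ifs with hij
  · subst hij
    have hr := hrest i i
    rw [if_pos rfl, mul_one, Complex.conj_mul'] at hr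
    push_cast
    refine Tendsto.mul ?_ hr
    have hl : (starRingEnd ℂ) (eigenvalue θ i k) * eigenvalue θ i k = 1 := by
      rw [Complex.conj_mul', norm_eigenvalue]; simp
    have hd := (hasDerivAt_eigenvalue hs i k).const_mul ((starRingEnd ℂ) (eigenvalue θ i k))
    have := tendsto_pow_of_hasDerivAt hd hl ξ
    convert this using 3
    linear_combination (-(ξ * bandVelocity θ i k * I)) * hl
  · have hr := (hrest i j).norm
    rw [if_neg hij, mul_zero, norm_zero] at hr
    refine squeeze_zero_norm (fun t => ?_) hr
    rw [norm_mul, norm_pow, norm_mul, RCLike.norm_conj, norm_eigenvalue, norm_eigenvalue, mul_one,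
      one_pow, one_mul]

theorem tendsto_charFun_rescaledLaw (hs : Real.sin θ ≠ 0) (h : ‖α‖ ^ 2 + ‖β‖ ^ 2 + ‖γ‖ ^ 2 = 1)
    (ξ : ℝ) :
    Tendsto (fun t => charFun (rescaledLaw θ α β γ t) ξ) atTop
      (𝓝 ((2 * Real.pi : ℂ)⁻¹ * ∫ k in -Real.pi..Real.pi,
        ∑ j, cexp (ξ * bandVelocity θ j k * I) * (‖amplitude θ ![α, β, γ] j k‖ ^ 2 : ℝ))) := by
  simp only [charFun_rescaledLaw h]
  refine Tendsto.const_mul _ ?_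
  refine intervalIntegral.tendsto_integral_filter_of_dominated_convergence (fun _ => 1) ?_ ?_
    (intervalIntegrable_const) ?_
  · refine Eventually.of_forall fun t => Continuous.aestronglyMeasurable ?_
    have hc := continuous_fourierState θ α β γ t
    exact (continuous_star.comp hc).dotProduct (hc.comp (continuous_sub_right _))
  · refine Eventually.of_forall fun t => Eventually.of_forall fun k _ => ?_
    refine (norm_star_dotProduct_le _ _).trans ?_
    rw [sum_norm_fourierState_sq, sum_norm_fourierState_sq, h]
    norm_num
  · exact Eventually.of_forall fun k _ => tendsto_star_fourierState_dotProduct hs α β γ k ξ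

end LongTime

/-! ### The limit law -/

section LimitLaw

open Complex

variable {θ : ℝ} {α β γ : ℂ}

/-- The mass of the atom at the origin: the average over wave numbers of the weight of the initial
state on the band of velocity `0`. -/
def atomMass (θ : ℝ) (α β γ : ℂ) : ℝ :=
  (2 * Real.pi)⁻¹ * ∫ k in -Real.pi..Real.pi, ‖amplitude θ ![α, β, γ] 0 k‖ ^ 2

theorem atomMass_nonneg (θ : ℝ) (α β γ : ℂ) : 0 ≤ atomMass θ α β γ :=
  mul_nonneg (by positivity) (intervalIntegral.integral_nonneg (by linarith [Real.pi_pos])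
    fun _ _ => by positivity)

/-- The weight of the initial state on a band, summed over opposite wave numbers. -/
def bandWeight (θ : ℝ) (α β γ : ℂ) (j : Fin 3) (k : ℝ) : ℝ :=
  ‖amplitude θ ![α, β, γ] j k‖ ^ 2 + ‖amplitude θ ![α, β, γ] j (-k)‖ ^ 2

theorem continuous_bandWeight (hs : Real.sin θ ≠ 0) (α β γ : ℂ) (j : Fin 3) :
    Continuous (bandWeight θ α β γ j) := by
  have := continuous_amplitude hs ![α, β, γ] j
  unfold bandWeight
  fun_prop

theorem bandWeight_nonneg (θ : ℝ) (α β γ : ℂ) (j : Fin 3) (k : ℝ) :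
    0 ≤ bandWeight θ α β γ j k := by
  unfold bandWeight; positivity

theorem intervalIntegral_neg_pi_pi {F : ℝ → ℂ} (hF : Continuous F) :
    ∫ k in -Real.pi..Real.pi, F k = ∫ k in Set.Ioo 0 Real.pi, (F k + F (-k)) := by
  have hF' : IntervalIntegrable (fun k => F (-k)) volume 0 Real.pi :=
    (hF.comp continuous_neg).intervalIntegrable _ _
  rw [← integral_Ioc_eq_integral_Ioo, ← intervalIntegral.integral_of_le Real.pi_pos.le,
    intervalIntegral.integral_add (hF.intervalIntegrable _ _) hF',
    intervalIntegral.integral_comp_neg, neg_zero, add_comm,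
    intervalIntegral.integral_add_adjacent_intervals (hF.intervalIntegrable _ _)
      (hF.intervalIntegrable _ _)]

theorem isFiniteMeasure_limitLaw (hint : Integrable (density θ α β γ)) (Δ : ℝ) :
    IsFiniteMeasure (limitLaw θ α β γ Δ) := by
  have : IsFiniteMeasure (volume.withDensity fun y => ENNReal.ofReal (density θ α β γ y)) :=
    isFiniteMeasure_withDensity_ofReal hint.hasFiniteIntegral
  have : IsFiniteMeasure (ENNReal.ofReal Δ • Measure.dirac (0 : ℝ)) :=
    Measure.smul_finite _ ENNReal.ofReal_ne_top
  unfold limitLaw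
  infer_instance

/-- The limit of the characteristic functions of `X_t / t` is the characteristic function of the
limit law. -/
theorem charFun_limitLaw (hs : Real.sin θ ≠ 0) (α β γ : ℂ) (ξ : ℝ) :
    charFun (limitLaw θ α β γ (atomMass θ α β γ)) ξ =
      (2 * Real.pi : ℂ)⁻¹ * ∫ k in -Real.pi..Real.pi,
        ∑ j, cexp (ξ * bandVelocity θ j k * I) * (‖amplitude θ ![α, β, γ] j k‖ ^ 2 : ℝ) := by
  have hint : Integrable (density θ α β γ) :=
    integrable_density hs (ν_velocity_eq hs α β γ) (continuous_bandWeight hs α β γ 1)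
      (ν_velocity_eq_swap hs α β γ) (continuous_bandWeight hs α β γ 2)
  have hnn : ∀ y, 0 ≤ density θ α β γ y :=
    density_nonneg hs (ν_velocity_eq hs α β γ) (bandWeight_nonneg θ α β γ 1)
      (ν_velocity_eq_swap hs α β γ) (bandWeight_nonneg θ α β γ 2)
  have hg : Continuous fun x : ℝ => cexp (ξ * x * I) := by fun_prop
  have hgn : ∀ x : ℝ, ‖cexp (ξ * x * I)‖ ≤ 1 := fun x => by
    rw [← Complex.ofReal_mul, Complex.norm_exp_ofReal_mul_I]
  have hfin := isFiniteMeasure_limitLaw hint (atomMass θ α β γ)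
  have hgi : Integrable (fun x : ℝ => cexp (ξ * x * I)) (limitLaw θ α β γ (atomMass θ α β γ)) :=
    Integrable.of_bound hg.aestronglyMeasurable 1 (Eventually.of_forall hgn)
  have hL : charFun (limitLaw θ α β γ (atomMass θ α β γ)) ξ = atomMass θ α β γ
      + ∫ y, density θ α β γ y • cexp (ξ * y * I) := by
    rw [charFun_apply_real]
    unfold limitLaw at hgi ⊢
    rw [integral_add_measure hgi.left_of_add_measure hgi.right_of_add_measure,
      integral_smul_measure, integral_dirac,
      integral_withDensity_eq_integral_toReal_smul₀ hint.aemeasurable.ennreal_ofReal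
        (Eventually.of_forall fun _ => ENNReal.ofReal_lt_top)]
    simp [ENNReal.toReal_ofReal, hnn, atomMass_nonneg]
  have hcF : ∀ j, Continuous fun k => cexp (ξ * bandVelocity θ j k * I)
      * (‖amplitude θ ![α, β, γ] j k‖ ^ 2 : ℝ) := by
    intro j
    have := continuous_amplitude hs ![α, β, γ] j
    have := continuous_bandVelocity hs j
    fun_prop
  have hband : ∀ (j : Fin 3) (h : ℝ → ℝ), (∀ k, bandVelocity θ j k = h k) →
      (∀ k, h (-k) = h k) → (2 * Real.pi : ℂ)⁻¹ * ∫ k in -Real.pi..Real.pi,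
        cexp (ξ * bandVelocity θ j k * I) * (‖amplitude θ ![α, β, γ] j k‖ ^ 2 : ℝ) =
      ∫ k in Set.Ioo 0 Real.pi, (bandWeight θ α β γ j k / (2 * Real.pi))
        • cexp (ξ * h k * I) := by
    intro j h hh heven
    rw [intervalIntegral_neg_pi_pi (hcF j), ← integral_const_mul]
    congr 1 with k
    rw [hh, hh, heven, bandWeight, Complex.real_smul]
    push_cast
    ring
  rw [hL, intervalIntegral.integral_finsetSum fun j _ => (hcF j).intervalIntegrable _ _,
    Fin.sum_univ_three, mul_add, mul_add, add_assoc,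
    hband 1 (velocity θ) (fun _ => rfl) (velocity_neg θ),
    hband 2 (fun k => -velocity θ k) (fun _ => rfl) (fun k => by rw [velocity_neg])]
  congr 1
  · simp only [bandVelocity, atomMass, Matrix.cons_val_zero, Complex.ofReal_zero, mul_zero,
      zero_mul, Complex.exp_zero, one_mul, intervalIntegral.integral_ofReal]
    push_cast
    rfl
  · exact integral_density hs (ν_velocity_eq hs α β γ) (continuous_bandWeight hs α β γ 1)
      (ν_velocity_eq_swap hs α β γ) (continuous_bandWeight hs α β γ 2) hg hgn

/-- The total mass is the value of the characteristic function at `0`, which is the squared norm of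
the initial state. -/
theorem isProbabilityMeasure_limitLaw (hs : Real.sin θ ≠ 0)
    (h : ‖α‖ ^ 2 + ‖β‖ ^ 2 + ‖γ‖ ^ 2 = 1) :
    IsProbabilityMeasure (limitLaw θ α β γ (atomMass θ α β γ)) := by
  have hfin := isFiniteMeasure_limitLaw (integrable_density hs (ν_velocity_eq hs α β γ)
    (continuous_bandWeight hs α β γ 1) (ν_velocity_eq_swap hs α β γ)
    (continuous_bandWeight hs α β γ 2)) (atomMass θ α β γ)
  have h0 := charFun_limitLaw hs α β γ 0
  have hsum : ∀ k, ∑ j, cexp ((0 : ℝ) * bandVelocity θ j k * I)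
      * (‖amplitude θ ![α, β, γ] j k‖ ^ 2 : ℝ) = 1 := by
    intro k
    have := sum_norm_amplitude_sq hs ![α, β, γ] k
    rw [Fin.sum_univ_three (fun i => ‖![α, β, γ] i‖ ^ 2)] at this
    simp only [Complex.ofReal_zero, zero_mul, Complex.exp_zero, one_mul]
    rw [← Complex.ofReal_sum, this]
    exact_mod_cast h
  have hπ : (Real.pi : ℂ) ≠ 0 := by exact_mod_cast Real.pi_ne_zero
  have hone : (2 * Real.pi : ℂ)⁻¹ * ∫ k in -Real.pi..Real.pi, (1 : ℂ) = 1 := by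
    rw [intervalIntegral.integral_const, Complex.real_smul]
    push_cast
    field_simp
    ring
  simp only [hsum] at h0
  rw [hone, charFun_zero] at h0
  have h1 : (limitLaw θ α β γ (atomMass θ α β γ)).real Set.univ = 1 := by exact_mod_cast h0
  exact ⟨(ENNReal.toReal_eq_one_iff _).1 h1⟩

theorem limitLaw_singleton {x Δ : ℝ} (hx : x ≠ 0 ∨ Δ = 0) : limitLaw θ α β γ Δ {x} = 0 := by
  have h1 : (volume.withDensity fun y => ENNReal.ofReal (density θ α β γ y)) {x} = 0 :=
    withDensity_absolutelyContinuous _ _ (measure_singleton x)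
  rw [limitLaw, Measure.add_apply, h1, add_zero, Measure.smul_apply, smul_eq_mul]
  rcases hx with hx | rfl
  · simp [hx.symm]
  · simp

theorem isProbabilityMeasure_rescaledLaw (h : ‖α‖ ^ 2 + ‖β‖ ^ 2 + ‖γ‖ ^ 2 = 1) (t : ℕ) :
    IsProbabilityMeasure (rescaledLaw θ α β γ t) := by
  have := isProbabilityMeasure_positionLaw θ α β γ h t
  exact Measure.isProbabilityMeasure_map (Measurable.of_discrete).aemeasurable

theorem tendsto_rescaledLaw_Iic (hs : Real.sin θ ≠ 0) (h : ‖α‖ ^ 2 + ‖β‖ ^ 2 + ‖γ‖ ^ 2 = 1) {x : ℝ}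
    (hx : x ≠ 0 ∨ atomMass θ α β γ = 0) :
    Tendsto (fun t : ℕ => (rescaledLaw θ α β γ t).real (Set.Iic x)) atTop
      (𝓝 ((limitLaw θ α β γ (atomMass θ α β γ)).real (Set.Iic x))) := by
  have hμ := isProbabilityMeasure_limitLaw hs h
  have hμt : ∀ t, IsProbabilityMeasure (rescaledLaw θ α β γ t) :=
    isProbabilityMeasure_rescaledLaw h
  let μ : ProbabilityMeasure ℝ := ⟨_, hμ⟩
  let μt : ℕ → ProbabilityMeasure ℝ := fun t => ⟨rescaledLaw θ α β γ t, hμt t⟩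
  have hlim : Tendsto μt atTop (𝓝 μ) := by
    refine ProbabilityMeasure.tendsto_iff_tendsto_charFun.2 fun ξ => ?_
    have := tendsto_charFun_rescaledLaw hs h ξ
    rw [← charFun_limitLaw hs α β γ ξ] at this
    exact this
  have hfr : (μ : Measure ℝ) (frontier (Set.Iic x)) = 0 := by
    rw [frontier_Iic]
    exact limitLaw_singleton hx
  have := ProbabilityMeasure.tendsto_measure_of_null_frontier_of_tendsto' hlim hfr
  exact (ENNReal.tendsto_toReal (measure_ne_top _ _)).comp this

theorem density_eq_zero_of_mem_gap {y : ℝ}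
    (hy : y ∈ Set.Ioo ((1 + 2 * Real.cos θ) / 3) (-((1 + 2 * Real.cos θ) / 3))) :
    density θ α β γ y = 0 := by
  have h1 : y ∉ D₁ θ := fun h => lt_asymm h.1 hy.2
  have h2 : y ∉ D₂ θ := fun h => lt_asymm h.2 hy.1
  rw [density, Set.indicator_of_notMem h1, Set.indicator_of_notMem h2, add_zero]

end LimitLaw

end QuantumWalk

end

theorem theorem1 (θ : ℝ) (hθ : θ ∈ Set.Ico 0 (2 * Real.pi)) (hθ0 : θ ≠ 0) (hθπ : θ ≠ Real.pi) :
    ∃ Δ : ℂ → ℂ → ℂ → ℝ, ∀ α β γ : ℂ, ‖α‖ ^ 2 + ‖β‖ ^ 2 + ‖γ‖ ^ 2 = 1 →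
      0 ≤ Δ α β γ ∧
      (∀ y : ℝ, 0 ≤ QuantumWalk.density θ α β γ y) ∧
      Integrable (QuantumWalk.density θ α β γ) volume ∧
      IsProbabilityMeasure (QuantumWalk.limitLaw θ α β γ (Δ α β γ)) ∧
      (∀ x : ℝ, (x ≠ 0 ∨ Δ α β γ = 0) →
        Tendsto (fun t : ℕ => (QuantumWalk.rescaledLaw θ α β γ t).real (Set.Iic x)) atTop
          (𝓝 ((QuantumWalk.limitLaw θ α β γ (Δ α β γ)).real (Set.Iic x)))) ∧
      (1 + 2 * Real.cos θ < 0 →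
        ∀ y ∈ Set.Ioo ((1 + 2 * Real.cos θ) / 3) (-((1 + 2 * Real.cos θ) / 3)),
          QuantumWalk.density θ α β γ y = 0) := by
  have hs : Real.sin θ ≠ 0 := by
    intro h0
    obtain ⟨n, hn⟩ := Real.sin_eq_zero_iff.1 h0
    have hπ := Real.pi_pos
    have h1 : (0 : ℝ) ≤ n := by
      by_contra! hneg
      nlinarith [hθ.1]
    have h2 : (n : ℝ) < 2 := by
      by_contra! hge
      nlinarith [hθ.2]
    have h1' : (0 : ℤ) ≤ n := by exact_mod_cast h1
    have h2' : n < 2 := by exact_mod_cast h2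
    interval_cases n
    · exact hθ0 (by simpa using hn.symm)
    · exact hθπ (by simpa using hn.symm)
  refine ⟨QuantumWalk.atomMass θ, fun α β γ h => ⟨QuantumWalk.atomMass_nonneg θ α β γ, ?_, ?_,
    QuantumWalk.isProbabilityMeasure_limitLaw hs h,
    fun x hx => QuantumWalk.tendsto_rescaledLaw_Iic hs h hx,
    fun _ y hy => QuantumWalk.density_eq_zero_of_mem_gap hy⟩⟩
  · exact QuantumWalk.density_nonneg hs (QuantumWalk.ν_velocity_eq hs α β γ)
      (QuantumWalk.bandWeight_nonneg θ α β γ 1) (QuantumWalk.ν_velocity_eq_swap hs α β γ)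
      (QuantumWalk.bandWeight_nonneg θ α β γ 2)
  · exact QuantumWalk.integrable_density hs (QuantumWalk.ν_velocity_eq hs α β γ)
      (QuantumWalk.continuous_bandWeight hs α β γ 1) (QuantumWalk.ν_velocity_eq_swap hs α β γ)
      (QuantumWalk.continuous_bandWeight hs α β γ 2)
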